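/- Let $0<\mu_1\le\mu_2\le\mu_3<1$, $0\le\nu_j\le1$, $a_j,b_j\in\mathbb R$ ($j=1,2,3$), $a_4\in\mathbb R$, and suppose that $$\Bigl|\sum_{j\in\{1,2\},\ \mu_j=\mu_3}a_j\Bigr|<|a_3|$$ (if $\mu_2<\mu_3$ this just says $a_3\neq0$). Let $\Psi:[0,\infty)\to\mathbb R$ be continuous with $\Psi(0)=0$ and continuously differentiable on $(0,\infty)$ with $\Psi'>0$ there. Let $f$ be measurable on $(0,\infty)$ and bounded on every $(0,T]$. Write, for $\mu>0$, $$I_\Psi^{\mu}y(t)=\frac1{\Gamma(\mu)}\int_0^t(\Psi(t)-\Psi(s))^{\mu-1}\Psi'(s)y(s)\,ds,\qquad I^0_\Psi y=y,$$ $$D_\Psi^{\mu,\nu}y=I_\Psi^{\nu(1-\mu)}\Bigl(\frac1{\Psi'}\frac{d}{dt}\Bigr)I_\Psi^{(1-\nu)(1-\mu)}y\quad(0<\mu<1),\qquad (g*_\Psi f)(t)=\int_0^t g\bigl(\Psi^{-1}(\Psi(t)-\Psi(\tau))\bigr)f(\tau)\Psi'(\tau)\,d\tau,$$ $$E^{\gamma}_{\mu,\nu}(z)=\frac1{\Gamma(\gamma)}\sum_{j\ge0}\frac{\Gamma(\gamma+j)z^j}{j!\,\Gamma(\mu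 j+\nu)},\qquad \rho_{k,i}=(\mu_3-\mu_2)k+(\mu_2-\mu_1)i+\mu_3 .$$ Consider the initial value problem $$\sum_{j=1}^3a_jD_\Psi^{\mu_j,\nu_j}y(t)+a_4y(t)=f(t)\quad(t>0),\qquad I_\Psi^{(1-\nu_j)(1-\mu_j)}y(0+)=b_j\quad(j=1,2,3),\tag{P}$$ where a solution is a continuous function $y$ on $(0,\infty)$, with $\Psi' y$ integrable on every $(0,T)$, such that each $I_\Psi^{(1-\nu_j)(1-\mu_j)}y$, with the value $b_j$ at $0$, is absolutely continuous on every $[0,T]$, the initial conditions hold as limits at $0+$, and the equation holds for almost every $t>0$. Put $$y_*(t)=\sum_{k=0}^\infty\frac{(-1)^k}{a_3^{k+1}}\sum_{i=0}^k\binom ki a_1^ia_2^{k-i}\Bigl[\Psi(t)^{\rho_{k,i}-1}\sum_{j=1}^3a_jb_j\Psi(t)^{\nu_j(1-\mu_j)}E^{k+1}_{\mu_3,\rho_{k,i}+\nu_j(1-\mu_j)}\bigl(-\tfrac{a_4}{a_3}\Psi(t)^{\mu_3}\bigr)$$ $$\qquad\qquad+\Bigl(\Psi^{\rho_{k,i}-1}E^{k+1}_{\mu_3,\rho_{k,i}}\bigl(-\tfrac{a_4}{a_3}\Psi^{\mu_3}\bigr)*_\Psi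 f\Bigr)(t)\Bigr].$$ Then: 1. For every $t>0$ the convolution integrals exist and the series over $k$ defining $y_*(t)$ converges absolutely. 2. Every solution $y$ of (P) satisfies $y(t)=y_*(t)$ for all $t>0$. In particular, whenever (P) is solvable, its solution is unique and is $y_*$. 3. Let $\gamma_j=\mu_j+\nu_j(1-\mu_j)$ and suppose that the initial values are compatible: there are $\beta,g\in\mathbb R$ with $\gamma_j\le g$ for all $j$, $b_j=\beta$ if $\gamma_j=g$ and $b_j=0$ if $\gamma_j<g$, and, if $\beta\ne0$, $\sum_{\mu_j=\mu_3,\ \gamma_j<g}a_j=0$. If moreover $f\in C^1(0,\infty)$ with $f'$ integrable on every $(0,T)$, then $y_*$ is a solution of (P); each $I_\Psi^{(1-\nu_j)(1-\mu_j)}y_*$ is differentiable at every $t>0$, and the equation holds at every $t>0$. -/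

import Mathlib

open Set Filter Topology MeasureTheory

noncomputable section

/-- The Prabhakar (three-parameter Mittag-Leffler) function `E_{μ,ν}^γ(z)`, for real arguments. -/
def prabhakar (μ ν γ z : ℝ) : ℝ :=
  1 / Real.Gamma γ *
    ∑' j : ℕ, Real.Gamma (γ + j) * z ^ j / ((Nat.factorial j : ℝ) * Real.Gamma (μ * j + ν))

/-- The `Ψ`-Riemann–Liouville integral of order `μ ≥ 0` with base point `0`;
order `0` is the identity operator. -/
def psiIntegral (Ψ : ℝ → ℝ) (μ : ℝ) (y : ℝ → ℝ) (t : ℝ) : ℝ :=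
  if μ = 0 then y t
  else 1 / Real.Gamma μ * ∫ s in (0 : ℝ)..t, (Ψ t - Ψ s) ^ (μ - 1) * deriv Ψ s * y s

/-- The operator `(1 / Ψ') d/dt`. -/
def psiDeriv (Ψ y : ℝ → ℝ) (t : ℝ) : ℝ := 1 / deriv Ψ t * deriv y t

/-- The `Ψ`-Hilfer derivative of order `μ > 0` and type `ν ∈ [0, 1]` with base point `0`:
`I^{ν(m-μ)} ((1/Ψ') d/dt)^m I^{(1-ν)(m-μ)} y`, where `m = ⌊μ⌋ + 1`. -/
def psiHilfer (Ψ : ℝ → ℝ) (μ ν : ℝ) (y : ℝ → ℝ) : ℝ → ℝ :=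
  psiIntegral Ψ (ν * (((⌊μ⌋₊ + 1 : ℕ) : ℝ) - μ))
    ((psiDeriv Ψ)^[⌊μ⌋₊ + 1]
      (psiIntegral Ψ ((1 - ν) * (((⌊μ⌋₊ + 1 : ℕ) : ℝ) - μ)) y))

/-- The integrand of the `Ψ`-convolution at time `t`. The inverse of `Ψ` is taken on `[0, ∞)`. -/
def psiConvIntegrand (Ψ f g : ℝ → ℝ) (t τ : ℝ) : ℝ :=
  f (Function.invFunOn Ψ (Ici 0) (Ψ t - Ψ τ)) * g τ * deriv Ψ τ

/-- The `Ψ`-convolution `f *_Ψ g`. -/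
def psiConv (Ψ f g : ℝ → ℝ) (t : ℝ) : ℝ :=
  ∫ τ in (0 : ℝ)..t, psiConvIntegrand Ψ f g t τ

/-- The left-hand side `∑_{j=1}^{3} a_j D^{μ_j,ν_j}_Ψ y (t) + a₄ y(t)` of the three-term equation.
The indices `1, 2, 3` of the mathematical text are `0, 1, 2 : Fin 3`. -/
def threeTermLHS (Ψ : ℝ → ℝ) (μ ν a : Fin 3 → ℝ) (a₄ : ℝ) (y : ℝ → ℝ) (t : ℝ) : ℝ :=
  (∑ j, a j * psiHilfer Ψ (μ j) (ν j) y t) + a₄ * y t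

/-- `y` is a solution on `(0, ∞)` of the initial value problem
`∑_{j=1}^{3} a_j D^{μ_j,ν_j}_Ψ y + a₄ y = f`, `I_Ψ^{(1-ν_j)(1-μ_j)} y (0) = b_j`.
The initial values are limits at `0+`; with these values at `0` the functions
`I_Ψ^{(1-ν_j)(1-μ_j)} y` are absolutely continuous on every `[0, T]`
(`absCont` and `deriv_integrable`), and the equation holds almost everywhere. -/
structure IsThreeTermSolution (Ψ : ℝ → ℝ) (μ ν a b : Fin 3 → ℝ) (a₄ : ℝ) (f y : ℝ → ℝ) :
    Prop where
  continuousOn : ContinuousOn y (Ioi 0)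
  integrable : ∀ T : ℝ, 0 < T → IntervalIntegrable (fun s => deriv Ψ s * y s) volume 0 T
  absCont : ∀ j : Fin 3, ∀ ε T : ℝ, 0 < ε → ε ≤ T →
    AbsolutelyContinuousOnInterval (psiIntegral Ψ ((1 - ν j) * (1 - μ j)) y) ε T
  deriv_integrable : ∀ j : Fin 3, ∀ T : ℝ, 0 < T →
    IntervalIntegrable (deriv (psiIntegral Ψ ((1 - ν j) * (1 - μ j)) y)) volume 0 T
  initial : ∀ j : Fin 3,
    Tendsto (psiIntegral Ψ ((1 - ν j) * (1 - μ j)) y) (𝓝[>] 0) (𝓝 (b j))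
  equation : ∀ᵐ t : ℝ, 0 < t → threeTermLHS Ψ μ ν a a₄ y t = f t

/-- The exponent `ρ_{k,i} = (μ₃ - μ₂) k + (μ₂ - μ₁) i + μ₃`. -/
def threeTermExponent (μ : Fin 3 → ℝ) (k i : ℕ) : ℝ :=
  (μ 2 - μ 1) * k + (μ 1 - μ 0) * i + μ 2

/-- `Ψ^{ρ_{k,i} - 1} E_{μ₃, ρ_{k,i}}^{k+1} (-(a₄/a₃) Ψ^{μ₃})`. -/
def threeTermKernel (Ψ : ℝ → ℝ) (μ a : Fin 3 → ℝ) (a₄ : ℝ) (k i : ℕ) (t : ℝ) : ℝ :=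
  Ψ t ^ (threeTermExponent μ k i - 1) *
    prabhakar (μ 2) (threeTermExponent μ k i) (k + 1) (-(a₄ / a 2) * Ψ t ^ μ 2)

/-- The `k`-th term of the solution series. -/
def threeTermSummand (Ψ : ℝ → ℝ) (μ ν a b : Fin 3 → ℝ) (a₄ : ℝ) (f : ℝ → ℝ)
    (t : ℝ) (k : ℕ) : ℝ :=
  (-1) ^ k / a 2 ^ (k + 1) * ∑ i ∈ Finset.range (k + 1),
    (Nat.choose k i : ℝ) * a 0 ^ i * a 1 ^ (k - i) *
      (Ψ t ^ (threeTermExponent μ k i - 1) *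
          (∑ j, a j * b j * Ψ t ^ (ν j * (1 - μ j)) *
            prabhakar (μ 2) (threeTermExponent μ k i + ν j * (1 - μ j)) (k + 1)
              (-(a₄ / a 2) * Ψ t ^ μ 2))
        + psiConv Ψ (threeTermKernel Ψ μ a a₄ k i) f t)

/-- The explicit solution: the double series. -/
def threeTermFormula (Ψ : ℝ → ℝ) (μ ν a b : Fin 3 → ℝ) (a₄ : ℝ) (f : ℝ → ℝ) (t : ℝ) : ℝ :=
  ∑' k : ℕ, threeTermSummand Ψ μ ν a b a₄ f t k

/-- Compatibility of the initial values. With `γ_j = μ_j + ν_j (1 - μ_j)`, a solution behaves like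
`β Ψ^{g-1} / Γ(g)` at `0+`, so that `I_Ψ^{1-γ_j} y (0+)` is `β` if `γ_j = g` and `0` if `γ_j < g`,
while for `β ≠ 0` the terms of highest order `μ₃` with `γ_j < g` must cancel.
All `b_j = 0` is always compatible (`β = 0`, `g = 1`). -/
def CompatibleInitialValues (μ ν a b : Fin 3 → ℝ) : Prop :=
  ∃ β g : ℝ,
    (∀ j, μ j + ν j * (1 - μ j) ≤ g) ∧
    (∀ j, b j = if μ j + ν j * (1 - μ j) = g then β else 0) ∧
    (β ≠ 0 → ∑ j, (if μ j = μ 2 ∧ μ j + ν j * (1 - μ j) < g then a j else 0) = 0)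

end

/-! The substitution x = Ψ(t) turns Ψ-integrals into Riemann–Liouville integrals I^s, that is,
Volterra convolutions with h_s(x) = x^(s-1)/Γ(s), and the Ψ-convolution into the ordinary one. Put
κ_j = ν_j(1-μ_j) and s_j = (1-ν_j)(1-μ_j), so that μ_j + κ_j + s_j = 1, and let w_j be the
derivative of I^{s_j} Y. The problem becomes ∑ a_j I^{κ_j} w_j + a₄ Y = F with I^{s_j} Y = b_j + ∫₀ˣ
w_j.

Formally, the inverse of a₃ + a₄ I^{μ₃} + a₂ I^{μ₃-μ₂} + a₁ I^{μ₃-μ₁} is expanded as a geometric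
series in the terms with a₁ and a₂, and each power of (1 + (a₄/a₃) I^{μ₃})⁻¹ by the negative
binomial series. Applied to h_σ this gives a double series of Prabhakar kernels, the resolvent
kernel R_σ. Two identities carry everything: R_σ * h_s = R_{σ+s} (`resolventKernel_vconv`) and ∑ a_j
R_{σ+μ₃-μ_j} + a₄ R_{σ+μ₃} = h_σ (`resolventKernel_eq`). The formula reads y_* = ∑ a_j b_j
R_{μ₃+κ_j} + R_{μ₃} * F.

Convergence: on (0, X] and for every l > 0, h_{σ+τ} is at most a constant times x^{σ-1} l^{-τ}
(`rlKernel_add_le`), so an integration of order τ counts as l^{-τ}. For large l only the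
coefficients of top order matter, and the hypothesis on a₃ makes the series geometric with ratio
below 1 (`AdmissibleOrders.exists_weight`, `dominatedSeries_resolvent`).

Uniqueness: convolving the equation with R_{μ₃+2} and using both identities gives h₂ * Y = h₂ * y_*;
two differentiations finish (`eq_threeTermSolution`).

Existence: for compatible data the resolvent equation at σ = g rewrites y_* as β h_g plus resolvent
kernels, and a convolution with one, all of index larger than every γ_j. Each piece can be
differentiated explicitly, only β h_g carries an initial value, and the equation is the resolvent
equation again (`exists_hasHilferDerivative_threeTermSolution`).

Since Ψ may be bounded, functions are transported only from (0, T] to (0, Ψ T] and then extended;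
the convolutions at x see only values on (0, x]. -/

noncomputable section

/-! ### Volterra convolution of functions singular at zero -/

/-- Integrability on every interval `(0, X)`. -/
def IntegrableNearZero (g : ℝ → ℝ) : Prop :=
  ∀ X : ℝ, 0 < X → IntervalIntegrable g volume 0 X

/-- Boundedness on every interval `(0, X]`. -/
def BoundedNearZero (g : ℝ → ℝ) : Prop :=
  ∀ X : ℝ, ∃ M : ℝ, ∀ x ∈ Ioc 0 X, |g x| ≤ M

/-- Integrability on every `(0, X)` together with boundedness on every `[ε, X]`. -/
structure VolterraBounded (g : ℝ → ℝ) : Prop where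
  int : IntegrableNearZero g
  bdd : ∀ ε X : ℝ, 0 < ε → ∃ M : ℝ, ∀ x ∈ Icc ε X, |g x| ≤ M

/-- Integrability on every `(0, X)` together with continuity on `(0, ∞)`. -/
structure VolterraContinuous (g : ℝ → ℝ) : Prop where
  int : IntegrableNearZero g
  cont : ContinuousOn g (Ioi 0)

/-- The Volterra convolution `∫_0^x g (x - s) w s ds`. -/
def vconv (g w : ℝ → ℝ) (x : ℝ) : ℝ := ∫ s in (0 : ℝ)..x, g (x - s) * w s

lemma VolterraContinuous.bounded {g : ℝ → ℝ} (hg : VolterraContinuous g) : VolterraBounded g := by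
  refine ⟨hg.int, fun ε X hε => ?_⟩
  obtain ⟨M, hM⟩ := (isCompact_Icc (a := ε) (b := X)).exists_bound_of_continuousOn
    (hg.cont.mono fun x hx => lt_of_lt_of_le hε hx.1)
  exact ⟨M, fun x hx => by simpa using hM x hx⟩

lemma vconv_comm (g w : ℝ → ℝ) (x : ℝ) : vconv g w x = vconv w g x := by
  unfold vconv
  have := intervalIntegral.integral_comp_sub_left (fun s => w (x - s) * g s) x (a := 0) (b := x)
  simp only [sub_sub_cancel, sub_zero, sub_self] at this
  rw [← this]
  exact intervalIntegral.integral_congr fun s _ => mul_comm _ _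

lemma integral_congr_Ioo {g h : ℝ → ℝ} {x : ℝ} (hx : 0 ≤ x) (H : ∀ u ∈ Ioo 0 x, g u = h u) :
    ∫ u in (0 : ℝ)..x, g u = ∫ u in (0 : ℝ)..x, h u := by
  rw [intervalIntegral.integral_of_le hx, intervalIntegral.integral_of_le hx,
    integral_Ioc_eq_integral_Ioo, integral_Ioc_eq_integral_Ioo]
  exact setIntegral_congr_fun measurableSet_Ioo H

lemma intervalIntegrable_congr_Ioo {g h : ℝ → ℝ} {x : ℝ} (hx : 0 ≤ x)
    (H : ∀ u ∈ Ioo 0 x, g u = h u) (hg : IntervalIntegrable g volume 0 x) :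
    IntervalIntegrable h volume 0 x := by
  rw [intervalIntegrable_iff_integrableOn_Ioo_of_le hx] at hg ⊢
  exact hg.congr_fun H measurableSet_Ioo

lemma vconv_congr {g g' w w' : ℝ → ℝ} {x : ℝ} (hx : 0 ≤ x) (hg : ∀ u ∈ Ioo 0 x, g u = g' u)
    (hw : ∀ u ∈ Ioo 0 x, w u = w' u) : vconv g w x = vconv g' w' x := by
  refine integral_congr_Ioo hx fun u hu => ?_
  rw [hw u hu, hg (x - u) ⟨by linarith [hu.2], by linarith [hu.1]⟩]

lemma IntervalIntegrable.mul_bounded {g w : ℝ → ℝ} {a b M : ℝ}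
    (hg : IntervalIntegrable g volume a b) (hw : IntervalIntegrable w volume a b)
    (hM : ∀ x ∈ uIoo a b, |g x| ≤ M) : IntervalIntegrable (fun s => g s * w s) volume a b := by
  rw [intervalIntegrable_iff, uIoc, integrableOn_Ioc_iff_integrableOn_Ioo] at *
  refine Integrable.bdd_mul hw hg.aestronglyMeasurable (c := M) ?_
  exact (ae_restrict_iff' measurableSet_Ioo).2 (Eventually.of_forall fun x hx => by
    simpa using hM x hx)

lemma IntegrableNearZero.comp_sub {g : ℝ → ℝ} (hg : IntegrableNearZero g) {x : ℝ} (hx : 0 < x) :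
    IntervalIntegrable (fun s => g (x - s)) volume 0 x := by
  simpa using ((hg x hx).comp_sub_left x).symm

/-- Near s = 0 only `w` can blow up and near s = x only the factor `g (x - s)`; cutting at x / 2
leaves a bounded factor times an integrable one on each half. Hence the convolution exists at every
x > 0, not just almost everywhere. -/
lemma VolterraBounded.integrable_mul {g w : ℝ → ℝ} (hg : VolterraBounded g)
    (hw : VolterraBounded w) {x : ℝ} (hx : 0 < x) :
    IntervalIntegrable (fun s => g (x - s) * w s) volume 0 x := by
  have h1 : uIcc 0 (x / 2) ⊆ uIcc 0 x := by
    rw [uIcc_of_le (by linarith), uIcc_of_le hx.le]; exact Icc_subset_Icc le_rfl (by linarith)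
  have h2 : uIcc (x / 2) x ⊆ uIcc 0 x := by
    rw [uIcc_of_le (by linarith), uIcc_of_le hx.le]; exact Icc_subset_Icc (by linarith) le_rfl
  refine IntervalIntegrable.trans (b := x / 2) ?_ ?_
  · obtain ⟨M, hM⟩ := hg.bdd (x / 2) x (by linarith)
    refine IntervalIntegrable.mul_bounded ((hg.int.comp_sub hx).mono_set h1)
      ((hw.int x hx).mono_set h1) (M := M) fun s hs => hM _ ?_
    rw [uIoo_of_le (by linarith)] at hs
    exact ⟨by linarith [hs.2], by linarith [hs.1]⟩
  · obtain ⟨M, hM⟩ := hw.bdd (x / 2) x (by linarith)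
    have := IntervalIntegrable.mul_bounded ((hw.int x hx).mono_set h2)
      ((hg.int.comp_sub hx).mono_set h2) (M := M) fun s hs => hM _ (by
        rw [uIoo_of_le (by linarith)] at hs
        exact ⟨hs.1.le, hs.2.le⟩)
    simpa only [mul_comm] using this

lemma BoundedNearZero.integrable_mul {g w : ℝ → ℝ} (hb : BoundedNearZero g)
    (hg : IntegrableNearZero g) (hw : IntegrableNearZero w) {x : ℝ} (hx : 0 < x) :
    IntervalIntegrable (fun s => g (x - s) * w s) volume 0 x := by
  obtain ⟨M, hM⟩ := hb x
  refine IntervalIntegrable.mul_bounded (hg.comp_sub hx) (hw x hx) (M := M) fun s hs => hM _ ?_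
  rw [uIoo_of_le hx.le] at hs
  exact ⟨by linarith [hs.2], by linarith [hs.1]⟩

lemma IntegrableNearZero.indicator {g : ℝ → ℝ} (hg : IntegrableNearZero g) {X : ℝ} (hX : 0 < X) :
    Integrable ((Ioc 0 X).indicator g) := by
  have := hg X hX
  rw [intervalIntegrable_iff_integrableOn_Ioc_of_le hX.le] at this
  exact this.integrable_indicator measurableSet_Ioc

open scoped Convolution in
lemma convolution_eq_vconv {f g : ℝ → ℝ} (hf : ∀ x ≤ 0, f x = 0) (hg : ∀ x ≤ 0, g x = 0)
    {x : ℝ} (hx : 0 ≤ x) : (f ⋆[ContinuousLinearMap.mul ℝ ℝ] g) x = vconv g f x := by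
  rw [convolution_def, vconv, intervalIntegral.integral_of_le hx,
    ← integral_indicator measurableSet_Ioc]
  congr 1 with t
  simp only [ContinuousLinearMap.mul_apply', indicator, mem_Ioc]
  split_ifs with h
  · exact mul_comm _ _
  · rcases le_or_gt t 0 with h0 | h0
    · rw [hf t h0, zero_mul]
    · rw [hg (x - t) (by by_contra h1; exact h ⟨h0, by linarith⟩), mul_zero]

open scoped Convolution in
lemma convolution_eq_zero {f g : ℝ → ℝ} (hf : ∀ x ≤ 0, f x = 0) (hg : ∀ x ≤ 0, g x = 0)
    {x : ℝ} (hx : x ≤ 0) : (f ⋆[ContinuousLinearMap.mul ℝ ℝ] g) x = 0 := by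
  rw [convolution_def]
  refine integral_eq_zero_of_ae (Eventually.of_forall fun t => ?_)
  simp only [ContinuousLinearMap.mul_apply', Pi.zero_apply]
  rcases le_or_gt t 0 with h0 | h0
  · rw [hf t h0, zero_mul]
  · rw [hg (x - t) (by linarith), mul_zero]

lemma indicator_Ioc_eq_zero (g : ℝ → ℝ) (X : ℝ) : ∀ x ≤ 0, (Ioc 0 X).indicator g x = 0 :=
  fun _ hx => indicator_of_notMem (fun h => absurd h.1 (not_lt.2 hx)) _

lemma indicator_Ioc_eq_self (g : ℝ → ℝ) {X x : ℝ} (hx : x ≤ X) :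
    ∀ u ∈ Ioo 0 x, (Ioc 0 X).indicator g u = g u :=
  fun u hu => indicator_of_mem (show u ∈ Ioc 0 X from ⟨hu.1, hu.2.le.trans hx⟩) _

open scoped Convolution in
lemma convolution_indicator_eq_vconv (f g : ℝ → ℝ) {X x : ℝ} (hx : 0 ≤ x) (hxX : x ≤ X) :
    ((Ioc 0 X).indicator f ⋆[ContinuousLinearMap.mul ℝ ℝ] (Ioc 0 X).indicator g) x
      = vconv g f x := by
  rw [convolution_eq_vconv (indicator_Ioc_eq_zero f X) (indicator_Ioc_eq_zero g X) hx]
  exact vconv_congr hx (indicator_Ioc_eq_self g hxX) (indicator_Ioc_eq_self f hxX)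

lemma IntegrableNearZero.vconv {g w : ℝ → ℝ} (hg : IntegrableNearZero g)
    (hw : IntegrableNearZero w) : IntegrableNearZero (vconv g w) := by
  intro X hX
  have := ((hw.indicator hX).integrable_convolution (ContinuousLinearMap.mul ℝ ℝ)
    (hg.indicator hX)).intervalIntegrable (a := 0) (b := X)
  refine intervalIntegrable_congr_Ioo hX.le (fun u hu => ?_) this
  exact convolution_indicator_eq_vconv w g hu.1.le hu.2.le

open scoped Convolution in
/-- Associativity of the Volterra convolution if the outer kernel is bounded. -/
lemma vconv_assoc_of_bounded {g h w : ℝ → ℝ} (hgb : BoundedNearZero g)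
    (hg : IntegrableNearZero g) (hh : IntegrableNearZero h) (hw : IntegrableNearZero w)
    {x : ℝ} (hx : 0 < x) : vconv g (vconv h w) x = vconv (vconv g h) w x := by
  set L := ContinuousLinearMap.mul ℝ ℝ
  obtain ⟨M, hM⟩ := hgb x
  have hM' : ∀ u, ‖(Ioc 0 x).indicator g u‖ ≤ max M 0 := by
    intro u
    by_cases hu : u ∈ Ioc 0 x
    · rw [indicator_of_mem hu]; exact (hM u hu).trans (le_max_left _ _)
    · rw [indicator_of_notMem hu]; simp
  have key := convolution_assoc (μ := volume) (ν := volume) L L L L (fun a b c => by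
      simp [L, mul_assoc])
    (x₀ := x) (hw.indicator hx).aestronglyMeasurable (hh.indicator hx).aestronglyMeasurable
    (hg.indicator hx).aestronglyMeasurable
    ((hw.indicator hx).ae_convolution_exists L (hh.indicator hx))
    ((hh.indicator hx).norm.ae_convolution_exists _ (hg.indicator hx).norm)
    (by
      -- Associativity at the single point x needs |w| to be integrable against |h| ⋆ |g|.
      -- Boundedness of `g` enters here: the inner convolution is at most the L¹ norm of `h` times
      -- the bound.
      refine Integrable.mul_bdd (c := (∫ t, ‖(Ioc 0 x).indicator h t‖) * max M 0)
        (hw.indicator hx).norm ?_ ?_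
      · have := ((hh.indicator hx).norm.integrable_convolution L
          (hg.indicator hx).norm).aestronglyMeasurable
        exact this.comp_quasiMeasurePreserving
          (quasiMeasurePreserving_sub_left_of_right_invariant volume x)
      · refine Eventually.of_forall fun t => ?_
        rw [convolution_def, ← integral_mul_const]
        refine (norm_integral_le_integral_norm _).trans ?_
        refine integral_mono_of_nonneg (Eventually.of_forall fun _ => norm_nonneg _)
          ((hh.indicator hx).norm.mul_const _) (Eventually.of_forall fun s => ?_)
        simp only [ContinuousLinearMap.mul_apply', norm_mul, norm_norm]
        gcongr
        exact hM' _)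
  have z1 := indicator_Ioc_eq_zero w x
  have z2 := indicator_Ioc_eq_zero h x
  have z3 := indicator_Ioc_eq_zero g x
  rw [convolution_eq_vconv (fun y hy => convolution_eq_zero z1 z2 hy) z3 hx.le,
    convolution_eq_vconv z1 (fun y hy => convolution_eq_zero z2 z3 hy) hx.le] at key
  rw [vconv_congr hx.le (fun u hu => (indicator_Ioc_eq_self g le_rfl u hu).symm)
      (fun u hu => (convolution_indicator_eq_vconv w h hu.1.le hu.2.le).symm), key]
  exact vconv_congr hx.le (fun u hu => convolution_indicator_eq_vconv h g hu.1.le hu.2.le)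
    (indicator_Ioc_eq_self w le_rfl)

lemma vconv_add_right {g w w' : ℝ → ℝ} {x : ℝ}
    (h : IntervalIntegrable (fun s => g (x - s) * w s) volume 0 x)
    (h' : IntervalIntegrable (fun s => g (x - s) * w' s) volume 0 x) :
    vconv g (fun s => w s + w' s) x = vconv g w x + vconv g w' x := by
  unfold vconv
  rw [← intervalIntegral.integral_add h h']
  simp only [mul_add]

lemma vconv_const_mul_right (g w : ℝ → ℝ) (c x : ℝ) :
    vconv g (fun s => c * w s) x = c * vconv g w x := by
  unfold vconv
  rw [← intervalIntegral.integral_const_mul]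
  exact intervalIntegral.integral_congr fun s _ => by ring

lemma vconv_sum_right {ι : Type*} (S : Finset ι) {g : ℝ → ℝ} {w : ι → ℝ → ℝ} {x : ℝ}
    (h : ∀ i ∈ S, IntervalIntegrable (fun s => g (x - s) * w i s) volume 0 x) :
    vconv g (fun s => ∑ i ∈ S, w i s) x = ∑ i ∈ S, vconv g (w i) x := by
  unfold vconv
  rw [← intervalIntegral.integral_finsetSum h]
  simp only [Finset.mul_sum]

/-! ### Continuity of convolutions and associativity for unbounded kernels -/

lemma tendsto_integral_abs_zero {g : ℝ → ℝ} (hg : IntegrableNearZero g) :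
    Tendsto (fun δ : ℝ => ∫ u in (0 : ℝ)..δ, |g u|) (𝓝[>] 0) (𝓝 0) := by
  have h1 : IntervalIntegrable (fun u => |g u|) volume 0 1 := (hg 1 one_pos).abs
  have := intervalIntegral.continuousOn_primitive_interval (μ := volume) (a := 0) (b := 1)
    (f := fun u => |g u|) (by
      rw [uIcc_of_le zero_le_one]
      exact (intervalIntegrable_iff_integrableOn_Icc_of_le zero_le_one).1 h1)
  have h0 := this 0 (by simp)
  unfold ContinuousWithinAt at h0
  simp only [intervalIntegral.integral_same] at h0
  refine h0.mono_left ?_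
  rw [uIcc_of_le zero_le_one]
  exact nhdsWithin_le_of_mem (mem_of_superset (Ioc_mem_nhdsGT one_pos) Ioc_subset_Icc_self)

/-- A cutoff that vanishes for u ≤ δ and equals 1 for u ≥ 2δ removes the singularity at zero, and
clamping the argument to [δ, X] keeps the product bounded and continuous on all of ℝ. Convolution of
an integrable function with such a `G` is continuous. -/
lemma VolterraContinuous.exists_bounded_continuous {g : ℝ → ℝ} (hg : VolterraContinuous g)
    {δ X : ℝ} (hδ : 0 < δ) (hX : 2 * δ ≤ X) : ∃ G : ℝ → ℝ, Continuous G ∧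
      BddAbove (range fun x => ‖G x‖) ∧ (∀ u ≤ 0, G u = 0) ∧
      (∀ u ∈ Ioc 0 (2 * δ), |g u - G u| ≤ |g u|) ∧ ∀ u ∈ Icc (2 * δ) X, G u = g u := by
  have hm : ∀ u : ℝ, max δ (min u X) ∈ Icc δ X := fun u =>
    ⟨le_max_left _ _, max_le (by linarith) (min_le_right _ _)⟩
  have hc : Continuous fun u : ℝ => g (max δ (min u X)) :=
    hg.cont.comp_continuous (by fun_prop) fun u => hδ.trans_le (hm u).1
  have hχ : ∀ u : ℝ, 0 ≤ min 1 (max 0 (u / δ - 1)) ∧ min 1 (max 0 (u / δ - 1)) ≤ 1 := fun u =>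
    ⟨le_min zero_le_one (le_max_left _ _), min_le_left _ _⟩
  obtain ⟨M, hM⟩ := hg.bounded.bdd δ X hδ
  have hsmall : ∀ u ≤ δ, min 1 (max 0 (u / δ - 1)) = 0 := fun u hu => by
    rw [max_eq_left (by rw [sub_nonpos, div_le_one hδ]; exact hu), min_eq_right zero_le_one]
  refine ⟨fun u => min 1 (max 0 (u / δ - 1)) * g (max δ (min u X)), ?_, ?_, ?_, ?_, ?_⟩
  · exact (by fun_prop : Continuous fun u : ℝ => min 1 (max 0 (u / δ - 1))).mul hc
  · refine ⟨M, ?_⟩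
    rintro _ ⟨u, rfl⟩
    simp only [norm_mul, Real.norm_eq_abs]
    rw [abs_of_nonneg (hχ u).1]
    exact (mul_le_of_le_one_left (abs_nonneg _) (hχ u).2).trans (hM _ (hm u))
  · intro u hu
    simp only [hsmall u (by linarith), zero_mul]
  · intro u hu
    rcases le_total u δ with h | h
    · simp only [hsmall u h, zero_mul, sub_zero, le_refl]
    · simp only [min_eq_left (hu.2.trans hX), max_eq_right h]
      rw [← one_sub_mul, abs_mul, abs_of_nonneg (by linarith [(hχ u).2])]
      exact mul_le_of_le_one_left (abs_nonneg _) (by linarith [(hχ u).1])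
  · intro u hu
    have h1 : δ ≤ u := by linarith [hu.1]
    have h2 : 1 ≤ max 0 (u / δ - 1) := by
      refine le_max_of_le_right ?_
      rw [le_sub_iff_add_le, le_div_iff₀ hδ]; linarith [hu.1]
    simp only [min_eq_left h2, one_mul, min_eq_left hu.2, max_eq_right h1]

/-- The Volterra convolution with a kernel that is continuous on `(0, ∞)` is continuous there. -/
lemma VolterraContinuous.vconv {g w : ℝ → ℝ} (hg : VolterraContinuous g)
    (hw : VolterraBounded w) : VolterraContinuous (vconv g w) := by
  refine ⟨hg.int.vconv hw.int, fun x₀ hx₀ => ContinuousAt.continuousWithinAt ?_⟩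
  have hx₀ : 0 < x₀ := hx₀
  refine continuousAt_of_locally_uniform_approx_of_continuousAt fun U hU => ?_
  obtain ⟨ε, hε, hεU⟩ := Metric.mem_uniformity_dist.1 hU
  obtain ⟨M, hM⟩ := hw.bdd (x₀ / 4) (2 * x₀) (by linarith)
  have hM0 : 0 ≤ M := (abs_nonneg _).trans (hM x₀ ⟨by linarith, by linarith⟩)
  have hlim := (tendsto_integral_abs_zero hg.int).const_mul M
  rw [mul_zero] at hlim
  -- `g` and its regularisation differ only on (0, η), where M times the mass of |g| is below ε; η <
  -- x₀ / 4 keeps x - s in [x₀ / 4, 2 x₀], where |w| ≤ M.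
  obtain ⟨η, hη1, hη2⟩ := (((tendsto_order.1 hlim).2 ε hε).and
    (Ioo_mem_nhdsGT (show (0 : ℝ) < x₀ / 4 by linarith))).exists
  obtain ⟨G, hGc, hGb, hG0, hG1, hG2⟩ := hg.exists_bounded_continuous (δ := η / 2) (X := 2 * x₀)
    (by linarith [hη2.1]) (by linarith [hη2.2])
  rw [show 2 * (η / 2) = η by ring] at hG1 hG2
  have hX : 0 < 2 * x₀ := by linarith
  have hcont := hGb.continuous_convolution_right_of_integrable (ContinuousLinearMap.mul ℝ ℝ)
    (hw.int.indicator hX) hGc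
  refine ⟨Ioo (x₀ / 2) (2 * x₀), Ioo_mem_nhds (by linarith) (by linarith), _,
    hcont.continuousAt, fun x hx => hεU ?_⟩
  have hx0 : 0 < x := by linarith [hx.1]
  have hGi : IntegrableNearZero G := fun X _ => hGc.intervalIntegrable _ _
  have hGB : VolterraBounded G := VolterraContinuous.bounded ⟨hGi, hGc.continuousOn⟩
  rw [convolution_eq_vconv (indicator_Ioc_eq_zero w _) hG0 hx0.le,
    vconv_congr hx0.le (fun _ _ => rfl) (indicator_Ioc_eq_self w hx.2.le), vconv_comm g,
    vconv_comm G, Real.dist_eq]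
  unfold _root_.vconv
  rw [← intervalIntegral.integral_sub (hw.integrable_mul hg.bounded hx0)
    (hw.integrable_mul hGB hx0)]
  have hηx : η ≤ x := by linarith [hη2.2, hx.1]
  have hsub : uIcc 0 η ⊆ uIcc 0 x := by
    rw [uIcc_of_le hη2.1.le, uIcc_of_le hx0.le]; exact Icc_subset_Icc le_rfl hηx
  have hI := (hw.integrable_mul hg.bounded hx0).sub (hw.integrable_mul hGB hx0)
  have hsub' : uIcc η x ⊆ uIcc 0 x := by
    rw [uIcc_of_le hηx, uIcc_of_le hx0.le]; exact Icc_subset_Icc hη2.1.le le_rfl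
  rw [← intervalIntegral.integral_add_adjacent_intervals (hI.mono_set hsub) (hI.mono_set hsub')]
  have hz : ∫ s in η..x, (w (x - s) * g s - w (x - s) * G s) = 0 := by
    rw [intervalIntegral.integral_congr (g := fun _ => 0) ?_, intervalIntegral.integral_zero]
    intro s hs
    rw [uIcc_of_le hηx] at hs
    simp only [hG2 s ⟨hs.1, hs.2.trans hx.2.le⟩, sub_self]
  rw [hz, add_zero]
  refine lt_of_le_of_lt ?_ hη1
  rw [← intervalIntegral.integral_const_mul, ← Real.norm_eq_abs]
  refine intervalIntegral.norm_integral_le_of_norm_le hη2.1.le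
    (Eventually.of_forall fun s hs => ?_) ((hg.int η hη2.1).abs.const_mul M)
  rw [← mul_sub, Real.norm_eq_abs, abs_mul]
  exact mul_le_mul (hM _ ⟨by linarith [hs.2, hx.1, hη2.2], by linarith [hs.1, hx.2]⟩)
    (hG1 s hs) (abs_nonneg _) hM0

lemma vconv_one (g : ℝ → ℝ) (x : ℝ) : vconv (fun _ => 1) g x = ∫ s in (0 : ℝ)..x, g s := by
  simp [vconv]

lemma integrableNearZero_const (c : ℝ) : IntegrableNearZero fun _ => c :=
  fun _ _ => intervalIntegrable_const

lemma boundedNearZero_const (c : ℝ) : BoundedNearZero fun _ => c :=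
  fun _ => ⟨|c|, fun _ _ => le_rfl⟩

lemma IntegrableNearZero.bounded_primitive {g : ℝ → ℝ} (hg : IntegrableNearZero g) :
    BoundedNearZero (_root_.vconv (fun _ => 1) g) := by
  intro X
  refine ⟨∫ s in (0 : ℝ)..X, |g s|, fun x hx => ?_⟩
  rw [vconv_one]
  have hX : 0 < X := hx.1.trans_le hx.2
  refine (intervalIntegral.abs_integral_le_integral_abs hx.1.le).trans ?_
  exact intervalIntegral.integral_mono_interval le_rfl hx.1.le hx.2
    (Eventually.of_forall fun _ => abs_nonneg _) (hg X hX).abs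

lemma VolterraContinuous.hasDerivAt_primitive {g : ℝ → ℝ} (hg : VolterraContinuous g) {x : ℝ}
    (hx : 0 < x) : HasDerivAt (_root_.vconv (fun _ => 1) g) (g x) x := by
  have : _root_.vconv (fun _ => 1) g = fun x => ∫ s in (0 : ℝ)..x, g s := funext (vconv_one g)
  rw [this]
  exact intervalIntegral.integral_hasDerivAt_right (hg.int x hx)
    (hg.cont.stronglyMeasurableAtFilter isOpen_Ioi x hx) (hg.cont.continuousAt (Ioi_mem_nhds hx))

lemma VolterraContinuous.eq_of_primitive_eq {g h : ℝ → ℝ} {X : ℝ} (hg : VolterraContinuous g)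
    (hh : VolterraContinuous h)
    (H : ∀ x ∈ Ioo 0 X, _root_.vconv (fun _ => 1) g x = _root_.vconv (fun _ => 1) h x) :
    ∀ x ∈ Ioo 0 X, g x = h x := by
  intro x hx
  refine (hg.hasDerivAt_primitive hx.1).unique
    ((hh.hasDerivAt_primitive hx.1).congr_of_eventuallyEq ?_)
  filter_upwards [Ioo_mem_nhds hx.1 hx.2] with u hu using H u hu

/-- Associativity of the Volterra convolution for kernels continuous on `(0, ∞)`. -/
lemma vconv_assoc {g h w : ℝ → ℝ} (hg : VolterraContinuous g) (hh : VolterraContinuous h)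
    (hw : VolterraContinuous w) {x : ℝ} (hx : 0 < x) :
    vconv g (vconv h w) x = vconv (vconv g h) w x := by
  have h1 := boundedNearZero_const 1
  have h1i := integrableNearZero_const 1
  have hp : BoundedNearZero (vconv (fun _ => 1) g) := hg.int.bounded_primitive
  -- It suffices to compare primitives, both sides being continuous: the outer kernels are then 1
  -- and 1 * g, which are bounded near zero even if `g` is not.
  refine VolterraContinuous.eq_of_primitive_eq (X := x + 1)
    (hg.vconv (hh.vconv hw.bounded).bounded)
    ((hg.vconv hh.bounded).vconv hw.bounded) (fun y hy => ?_) x ⟨hx, by linarith⟩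
  rw [vconv_assoc_of_bounded h1 h1i hg.int (hh.int.vconv hw.int) hy.1,
    vconv_assoc_of_bounded hp (h1i.vconv hg.int) hh.int hw.int hy.1,
    vconv_assoc_of_bounded h1 h1i (hg.int.vconv hh.int) hw.int hy.1]
  refine vconv_congr hy.1.le (fun u hu => ?_) fun _ _ => rfl
  exact (vconv_assoc_of_bounded h1 h1i hg.int hh.int hu.1).symm

/-! ### Riemann–Liouville kernels and their weighted majorant -/

/-- The Riemann–Liouville kernel `x^{σ-1} / Γ(σ)`. -/
def rlKernel (σ x : ℝ) : ℝ := x ^ (σ - 1) / Real.Gamma σ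

lemma rlKernel_one (x : ℝ) : rlKernel 1 x = 1 := by simp [rlKernel]

lemma volterraContinuous_rpow {σ : ℝ} (hσ : 0 < σ) :
    VolterraContinuous fun x : ℝ => x ^ (σ - 1) :=
  ⟨fun _ _ => intervalIntegral.intervalIntegrable_rpow' (by linarith),
    fun x hx => (Real.continuousAt_rpow_const x _ (Or.inl (ne_of_gt hx))).continuousWithinAt⟩

lemma volterraContinuous_rlKernel {σ : ℝ} (hσ : 0 < σ) : VolterraContinuous (rlKernel σ) :=
  ⟨fun X hX => ((volterraContinuous_rpow hσ).int X hX).div_const _,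
    (volterraContinuous_rpow hσ).cont.div_const _⟩

lemma rlKernel_nonneg {σ x : ℝ} (hσ : 0 < σ) (hx : 0 ≤ x) : 0 ≤ rlKernel σ x :=
  div_nonneg (Real.rpow_nonneg hx _) (Real.Gamma_pos_of_pos hσ).le

lemma integral_rpow_mul_rpow {s σ x : ℝ} (hs : 0 < s) (hσ : 0 < σ) (hx : 0 < x) :
    ∫ u in (0 : ℝ)..x, (x - u) ^ (s - 1) * u ^ (σ - 1)
      = x ^ (s + σ - 1) * (Real.Gamma s * Real.Gamma σ / Real.Gamma (s + σ)) := by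
  have h := Complex.betaIntegral_scaled (σ : ℂ) (s : ℂ) hx
  have h2 := Complex.Gamma_mul_Gamma_eq_betaIntegral (s := (σ : ℂ)) (t := (s : ℂ)) (by simpa)
    (by simpa)
  have hΓ : Real.Gamma (s + σ) ≠ 0 := (Real.Gamma_pos_of_pos (by linarith)).ne'
  have h3 : Complex.betaIntegral σ s
      = ((Real.Gamma s * Real.Gamma σ / Real.Gamma (s + σ) : ℝ) : ℂ) := by
    rw [← Complex.ofReal_add, Complex.Gamma_ofReal, Complex.Gamma_ofReal, Complex.Gamma_ofReal,
      add_comm σ s] at h2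
    have : (Real.Gamma (s + σ) : ℂ) ≠ 0 := by exact_mod_cast hΓ
    push_cast
    rw [eq_div_iff this, mul_comm, ← h2, mul_comm]
  have h4 : ∫ u in (0 : ℝ)..x, (u : ℂ) ^ ((σ : ℂ) - 1) * ((x : ℂ) - u) ^ ((s : ℂ) - 1)
      = ((∫ u in (0 : ℝ)..x, (x - u) ^ (s - 1) * u ^ (σ - 1) : ℝ) : ℂ) := by
    rw [← intervalIntegral.integral_ofReal]
    refine intervalIntegral.integral_congr fun u hu => ?_
    rw [uIcc_of_le hx.le] at hu
    push_cast
    rw [Complex.ofReal_cpow (by linarith [hu.2]), Complex.ofReal_cpow hu.1, mul_comm]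
    push_cast
    rfl
  rw [h4, h3] at h
  have h5 : (x : ℂ) ^ ((σ : ℂ) + s - 1) = ((x ^ (s + σ - 1) : ℝ) : ℂ) := by
    rw [Complex.ofReal_cpow hx.le]
    push_cast
    rw [add_comm (σ : ℂ)]
  rw [h5] at h
  exact_mod_cast h

lemma vconv_rlKernel {s σ x : ℝ} (hs : 0 < s) (hσ : 0 < σ) (hx : 0 < x) :
    vconv (rlKernel s) (rlKernel σ) x = rlKernel (s + σ) x := by
  have h1 := (Real.Gamma_pos_of_pos hs).ne'
  have h2 := (Real.Gamma_pos_of_pos hσ).ne'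
  have : vconv (rlKernel s) (rlKernel σ) x
      = (∫ u in (0 : ℝ)..x, (x - u) ^ (s - 1) * u ^ (σ - 1))
        * (1 / (Real.Gamma s * Real.Gamma σ)) := by
    rw [← intervalIntegral.integral_mul_const]
    refine intervalIntegral.integral_congr fun u _ => ?_
    simp only [rlKernel]
    field_simp
  rw [this, integral_rpow_mul_rpow hs hσ hx, rlKernel]
  field_simp

/-- The Gamma integral is bounded below by its part over (z + 1, z + 2]. There u ≥ 1, so u^(1-σ) ≤ u
≤ z + 2 whatever σ > 0 is, which makes the constant independent of σ and τ. -/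
lemma rpow_le_mul_Gamma {σ τ z : ℝ} (hσ : 0 < σ) (hτ : 0 ≤ τ) (hz : 0 ≤ z) :
    z ^ τ ≤ (z + 2) * Real.exp (z + 2) * Real.Gamma (σ + τ) := by
  have hs : 0 < σ + τ := by linarith
  have hint := Real.GammaIntegral_convergent hs
  have hsub : Ioc (z + 1) (z + 2) ⊆ Ioi 0 := fun u hu => by
    have := hu.1; simp only [mem_Ioi]; linarith
  have hle : ∫ u in Ioc (z + 1) (z + 2), z ^ τ / (z + 2) * Real.exp (-(z + 2))
      ≤ ∫ u in Ioc (z + 1) (z + 2), Real.exp (-u) * u ^ (σ + τ - 1) := by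
    refine setIntegral_mono_on (integrableOn_const (by simp)) (hint.mono_set hsub)
      measurableSet_Ioc fun u hu => ?_
    have hu1 : 1 ≤ u := by linarith [hu.1]
    have hu0 : 0 < u := by linarith
    have h1 : z ^ τ ≤ u ^ (σ + τ - 1) * (z + 2) := by
      calc z ^ τ ≤ u ^ τ := Real.rpow_le_rpow hz (by linarith [hu.1]) hτ
        _ = u ^ (σ + τ - 1) * u ^ (1 - σ) := by rw [← Real.rpow_add hu0]; congr 1; ring
        _ ≤ u ^ (σ + τ - 1) * u ^ (1 : ℝ) := by
            gcongr
            linarith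
        _ ≤ u ^ (σ + τ - 1) * (z + 2) := by
            rw [Real.rpow_one]; gcongr; exact hu.2
    have h2 : z ^ τ / (z + 2) ≤ u ^ (σ + τ - 1) := by
      rw [div_le_iff₀ (by linarith)]; exact h1
    rw [mul_comm]
    gcongr
    exact hu.2
  have hle2 : ∫ u in Ioc (z + 1) (z + 2), Real.exp (-u) * u ^ (σ + τ - 1)
      ≤ Real.Gamma (σ + τ) := by
    rw [Real.Gamma_eq_integral hs]
    refine setIntegral_mono_set hint ?_ hsub.eventuallyLE
    exact (ae_restrict_iff' measurableSet_Ioi).2 (Eventually.of_forall fun u hu =>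
      mul_nonneg (Real.exp_pos _).le (Real.rpow_nonneg (le_of_lt hu) _))
  have h3 := hle.trans hle2
  simp only [integral_const, MeasurableSet.univ, measureReal_restrict_apply, univ_inter,
    Real.volume_real_Ioc, smul_eq_mul] at h3
  rw [show z + 2 - (z + 1) = 1 by ring, max_eq_left zero_le_one, one_mul, Real.exp_neg,
    ← div_eq_mul_inv, div_div, div_le_iff₀ (by positivity)] at h3
  linarith

/-- The constant in the majorant of `rlKernel_add_le`. -/
def rlBound (z : ℝ) : ℝ := (z + 2) * Real.exp (z + 2)

/-- Writing X^τ = l^(-τ) (l X)^τ, the second factor is absorbed by the Gamma function. Each order τ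
of integration thus gains l^(-τ) at the price of a constant depending on l X alone, as in an
exponentially weighted norm. -/
lemma rlKernel_add_le {σ τ l x X : ℝ} (hσ : 0 < σ) (hτ : 0 ≤ τ) (hl : 0 < l) (hx : 0 < x)
    (hX : x ≤ X) : rlKernel (σ + τ) x ≤ rlBound (l * X) * x ^ (σ - 1) * l ^ (-τ) := by
  have hΓ : 0 < Real.Gamma (σ + τ) := Real.Gamma_pos_of_pos (by linarith)
  have hX0 : 0 < X := hx.trans_le hX
  rw [rlKernel, div_le_iff₀ hΓ]
  have h1 := rpow_le_mul_Gamma hσ hτ (show 0 ≤ l * X by positivity)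
  calc x ^ (σ + τ - 1) = x ^ (σ - 1) * x ^ τ := by rw [← Real.rpow_add hx]; congr 1; ring
    _ ≤ x ^ (σ - 1) * X ^ τ := by gcongr
    _ = x ^ (σ - 1) * l ^ (-τ) * (l * X) ^ τ := by
        rw [Real.mul_rpow hl.le hX0.le, Real.rpow_neg hl.le]
        have : l ^ τ ≠ 0 := (Real.rpow_pos_of_pos hl _).ne'
        field_simp
    _ ≤ x ^ (σ - 1) * l ^ (-τ) * ((l * X + 2) * Real.exp (l * X + 2) * Real.Gamma (σ + τ)) := by
        gcongr
    _ = _ := by unfold rlBound; ring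

/-! ### Dominated series and term-by-term convolution -/

/-- A series of functions continuous on `(0, ∞)` which near zero is dominated by a summable
multiple of `x^{σ-1}`. -/
structure DominatedSeries (σ : ℝ) (u : ℕ → ℝ → ℝ) : Prop where
  cont : ∀ n, ContinuousOn (u n) (Ioi 0)
  bound : ∀ X : ℝ, 0 < X → ∃ ε : ℕ → ℝ, Summable ε ∧
    ∀ n, ∀ x ∈ Ioc 0 X, |u n x| ≤ ε n * x ^ (σ - 1)

lemma volterraContinuous_of_le {σ : ℝ} (hσ : 0 < σ) {g : ℝ → ℝ} (hg : ContinuousOn g (Ioi 0))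
    (hb : ∀ X : ℝ, 0 < X → ∃ C : ℝ, ∀ x ∈ Ioc 0 X, |g x| ≤ C * x ^ (σ - 1)) :
    VolterraContinuous g := by
  refine ⟨fun X hX => ?_, hg⟩
  obtain ⟨C, hC⟩ := hb X hX
  refine (((volterraContinuous_rpow hσ).int X hX).const_mul C).mono_fun ?_ ?_
  · rw [uIoc_of_le hX.le]
    exact (hg.mono fun u hu => hu.1).aestronglyMeasurable measurableSet_Ioc
  · rw [uIoc_of_le hX.le]
    refine (ae_restrict_iff' measurableSet_Ioc).2 (Eventually.of_forall fun x hx => ?_)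
    exact (hC x hx).trans (le_abs_self _)

namespace DominatedSeries

variable {σ : ℝ} {u : ℕ → ℝ → ℝ}

lemma volterraContinuous_term (hu : DominatedSeries σ u) (hσ : 0 < σ) (n : ℕ) :
    VolterraContinuous (u n) :=
  volterraContinuous_of_le hσ (hu.cont n) fun X hX => by
    obtain ⟨ε, -, h⟩ := hu.bound X hX
    exact ⟨ε n, h n⟩

lemma summable (hu : DominatedSeries σ u) {x : ℝ} (hx : 0 < x) : Summable fun n => u n x := by
  obtain ⟨ε, hε, h⟩ := hu.bound x hx
  exact Summable.of_norm_bounded (hε.mul_right (x ^ (σ - 1))) fun n => h n x ⟨hx, le_rfl⟩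

lemma tsum_le (hu : DominatedSeries σ u) {X : ℝ} (hX : 0 < X) :
    ∃ C, ∀ x ∈ Ioc 0 X, |∑' n, u n x| ≤ C * x ^ (σ - 1) := by
  obtain ⟨ε, hε, h⟩ := hu.bound X hX
  refine ⟨∑' n, ε n, fun x hx => ?_⟩
  rw [← tsum_mul_right]
  exact tsum_of_norm_bounded (f := fun n => u n x) (hε.mul_right (x ^ (σ - 1))).hasSum
    fun n => h n x hx

lemma volterraContinuous_tsum (hu : DominatedSeries σ u) (hσ : 0 < σ) :
    VolterraContinuous fun x => ∑' n, u n x := by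
  refine volterraContinuous_of_le hσ (fun x hx => ?_) fun X hX => hu.tsum_le hX
  have hx : 0 < x := hx
  obtain ⟨ε, hε, h⟩ := hu.bound (2 * x) (by linarith)
  obtain ⟨M, hM⟩ := (volterraContinuous_rpow hσ).bounded.bdd (x / 2) (2 * x) (by linarith)
  have hc : ContinuousOn (fun y => ∑' n, u n y) (Ioo (x / 2) (2 * x)) := by
    refine continuousOn_tsum (fun n => (hu.cont n).mono fun y hy => ?_) (hε.norm.mul_right M)
      fun n y hy => ?_
    · have := hy.1; simp only [mem_Ioi]; linarith
    · have hy0 : 0 < y := by linarith [hy.1]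
      calc |u n y| ≤ ε n * y ^ (σ - 1) := h n y ⟨hy0, hy.2.le⟩
        _ ≤ |ε n| * |y ^ (σ - 1)| := by rw [← abs_mul]; exact le_abs_self _
        _ ≤ |ε n| * M := by gcongr; exact hM y ⟨hy.1.le, hy.2.le⟩
  exact (hc.continuousAt (Ioo_mem_nhds (by linarith) (by linarith))).continuousWithinAt

/-- The L¹ norms of the integrands are summable: the n-th is at most `ε n` times the integral of (x
- s)^(σ-1) |w s|, which is finite because the power is itself a Volterra kernel. -/
lemma hasSum_vconv (hu : DominatedSeries σ u) (hσ : 0 < σ) {w : ℝ → ℝ} (hw : VolterraBounded w)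
    {x : ℝ} (hx : 0 < x) :
    HasSum (fun n => vconv (u n) w x) (vconv (fun y => ∑' n, u n y) w x) := by
  obtain ⟨ε, hε, h⟩ := hu.bound x hx
  have hi : ∀ n, IntegrableOn (fun s => u n (x - s) * w s) (Ioo 0 x) := fun n =>
    (intervalIntegrable_iff_integrableOn_Ioo_of_le hx.le).1
      ((hu.volterraContinuous_term hσ n).bounded.integrable_mul hw hx)
  have hp : IntegrableOn (fun s => (x - s) ^ (σ - 1) * w s) (Ioo 0 x) :=
    (intervalIntegrable_iff_integrableOn_Ioo_of_le hx.le).1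
      ((volterraContinuous_rpow hσ).bounded.integrable_mul hw hx)
  have key := hasSum_integral_of_summable_integral_norm hi (by
    refine Summable.of_nonneg_of_le (fun n => integral_nonneg fun _ => norm_nonneg _)
      (fun n => ?_) (hε.mul_right (∫ s in Ioo 0 x, ‖(x - s) ^ (σ - 1) * w s‖))
    rw [← integral_const_mul]
    refine setIntegral_mono_on (hi n).norm (hp.norm.const_mul _) measurableSet_Ioo fun s hs => ?_
    have hxs : 0 < x - s := by linarith [hs.2]
    simp only [norm_mul, Real.norm_eq_abs, abs_of_nonneg (Real.rpow_nonneg hxs.le _)]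
    rw [← mul_assoc]
    gcongr
    exact h n _ ⟨hxs, by linarith [hs.1]⟩)
  have e : ∀ g : ℝ → ℝ, vconv g w x = ∫ s in Ioo 0 x, g (x - s) * w s := fun g => by
    rw [vconv, intervalIntegral.integral_of_le hx.le, integral_Ioc_eq_integral_Ioo]
  simp only [e, ← tsum_mul_right]
  exact key

end DominatedSeries

/-! ### Prabhakar kernels -/

/-- The kernel `x^{σ-1} E^{k+1}_{r,σ}(-c x^r)`, as a series of Riemann–Liouville kernels. -/
def prabhakarKernel (c r : ℝ) (k : ℕ) (σ x : ℝ) : ℝ :=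
  ∑' j : ℕ, ((j + k).choose k : ℝ) * (-c) ^ j * rlKernel (σ + r * j) x

/-- For the integer parameter k + 1, the quotient Γ(k + 1 + j) / (Γ(k + 1) j!) is a binomial
coefficient. -/
lemma prabhakarKernel_eq (c r : ℝ) (k : ℕ) (σ : ℝ) {x : ℝ} (hx : 0 < x) :
    x ^ (σ - 1) * prabhakar r σ (k + 1) (-c * x ^ r) = prabhakarKernel c r k σ x := by
  unfold prabhakar prabhakarKernel
  rw [← mul_assoc, ← tsum_mul_left]
  refine tsum_congr fun j => ?_
  have e1 : Real.Gamma ((k : ℝ) + 1) = (k.factorial : ℝ) := Real.Gamma_nat_eq_factorial k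
  have e2 : Real.Gamma ((k : ℝ) + 1 + j) = ((j + k).factorial : ℝ) := by
    rw [← Real.Gamma_nat_eq_factorial]; push_cast; congr 1; ring
  have e3 : ((j + k).factorial : ℝ) = (j + k).choose k * k.factorial * j.factorial := by
    rw [← Nat.add_choose_mul_factorial_mul_factorial j k]; push_cast; ring
  have e4 : (x ^ r) ^ j = x ^ (r * j) := by rw [Real.rpow_mul hx.le, Real.rpow_natCast]
  have e5 : x ^ (σ + r * j - 1) = x ^ (σ - 1) * x ^ (r * j) := by
    rw [← Real.rpow_add hx]; congr 1; ring
  have hk : (k.factorial : ℝ) ≠ 0 := by positivity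
  have hj : (j.factorial : ℝ) ≠ 0 := by positivity
  rw [e1, e2, e3, mul_pow, e4, rlKernel, e5, add_comm σ]
  rw [one_div, mul_assoc, ← mul_div_assoc]
  -- No sign is imposed on `r` or `σ`, so Γ may be evaluated at a pole; its value there is 0, and
  -- both sides vanish because division by zero gives 0.
  by_cases hΓ : Real.Gamma (r * j + σ) = 0
  · simp [hΓ]
  · field_simp

section Prabhakar

variable {c r l : ℝ}

lemma abs_prabhakarTerm_le (hr : 0 ≤ r) (hl : 0 < l) {σ τ x X : ℝ} (hσ : 0 < σ) (hτ : 0 ≤ τ)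
    (hx : x ∈ Ioc 0 X) (k j : ℕ) :
    |((j + k).choose k : ℝ) * (-c) ^ j * rlKernel (σ + τ + r * j) x| ≤
      rlBound (l * X) * x ^ (σ - 1) * l ^ (-τ) *
        (((j + k).choose k : ℝ) * (|c| * l ^ (-r)) ^ j) := by
  have hrj : 0 ≤ r * j := by positivity
  have h := rlKernel_add_le hσ (add_nonneg hτ hrj) hl hx.1 hx.2
  have e : l ^ (-(τ + r * j)) = l ^ (-τ) * (l ^ (-r)) ^ j := by
    rw [← Real.rpow_natCast, ← Real.rpow_mul hl.le, ← Real.rpow_add hl]; congr 1; ring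
  rw [e, ← add_assoc] at h
  rw [abs_mul, abs_mul, abs_pow, abs_neg, abs_of_nonneg (Nat.cast_nonneg _),
    abs_of_nonneg (rlKernel_nonneg (by positivity) hx.1.le)]
  calc _ ≤ ((j + k).choose k : ℝ) * |c| ^ j *
        (rlBound (l * X) * x ^ (σ - 1) * (l ^ (-τ) * (l ^ (-r)) ^ j)) := by gcongr
    _ = _ := by rw [mul_pow]; ring

lemma hasSum_prabhakarBound (hl : 0 < l) (hc : |c| * l ^ (-r) < 1) (k : ℕ) :
    HasSum (fun j : ℕ => ((j + k).choose k : ℝ) * (|c| * l ^ (-r)) ^ j)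
      (1 / (1 - |c| * l ^ (-r)) ^ (k + 1)) :=
  hasSum_choose_mul_geometric_of_norm_lt_one k (by
    rw [Real.norm_eq_abs, abs_of_nonneg (by positivity)]; exact hc)

lemma dominatedSeries_prabhakar (hr : 0 ≤ r) (hl : 0 < l) (hc : |c| * l ^ (-r) < 1) {σ : ℝ}
    (hσ : 0 < σ) (k : ℕ) : DominatedSeries σ fun j x =>
      ((j + k).choose k : ℝ) * (-c) ^ j * rlKernel (σ + r * j) x := by
  refine ⟨fun j => ((volterraContinuous_rlKernel (by positivity)).cont.const_mul _), fun X hX =>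
    ⟨_, (hasSum_prabhakarBound hl hc k).summable.mul_left (rlBound (l * X)), fun j x hx => ?_⟩⟩
  have := abs_prabhakarTerm_le (c := c) hr hl hσ le_rfl hx k j
  simp only [add_zero, neg_zero, Real.rpow_zero, mul_one] at this
  linarith

lemma abs_prabhakarKernel_le (hr : 0 ≤ r) (hl : 0 < l) (hc : |c| * l ^ (-r) < 1)
    {σ τ x X : ℝ} (hσ : 0 < σ) (hτ : 0 ≤ τ) (hx : x ∈ Ioc 0 X) (k : ℕ) :
    |prabhakarKernel c r k (σ + τ) x| ≤
      rlBound (l * X) * x ^ (σ - 1) * l ^ (-τ) * (1 / (1 - |c| * l ^ (-r)) ^ (k + 1)) := by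
  rw [← Real.norm_eq_abs]
  exact tsum_of_norm_bounded ((hasSum_prabhakarBound hl hc k).mul_left _) fun j =>
    abs_prabhakarTerm_le hr hl hσ hτ hx k j

lemma volterraContinuous_prabhakarKernel (hr : 0 ≤ r) (hl : 0 < l) (hc : |c| * l ^ (-r) < 1)
    {σ : ℝ} (hσ : 0 < σ) (k : ℕ) : VolterraContinuous (prabhakarKernel c r k σ) :=
  (dominatedSeries_prabhakar hr hl hc hσ k).volterraContinuous_tsum hσ

lemma vconv_prabhakarKernel (hr : 0 ≤ r) (hl : 0 < l) (hc : |c| * l ^ (-r) < 1)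
    {σ s x : ℝ} (hσ : 0 < σ) (hs : 0 < s) (hx : 0 < x) (k : ℕ) :
    vconv (prabhakarKernel c r k σ) (rlKernel s) x = prabhakarKernel c r k (σ + s) x := by
  have h := (dominatedSeries_prabhakar hr hl hc hσ k).hasSum_vconv hσ
    (volterraContinuous_rlKernel hs).bounded hx
  change vconv (fun y => ∑' j : ℕ, _) _ _ = ∑' j : ℕ, _
  rw [← h.tsum_eq]
  refine tsum_congr fun j => ?_
  have hj : 0 < σ + r * j := by positivity
  rw [vconv_comm, vconv_const_mul_right, vconv_rlKernel hs hj hx]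
  congr 2
  ring

/-- The kernel represents (1 + c I^r)^{-(k+1)} h_σ, so applying 1 + c I^r lowers the exponent by
one. On coefficients this is Pascal's rule; for k = 0 the geometric series telescopes to its first
term. -/
lemma prabhakarKernel_add (hr : 0 ≤ r) (hl : 0 < l) (hc : |c| * l ^ (-r) < 1)
    {σ x : ℝ} (hσ : 0 < σ) (hx : 0 < x) (k : ℕ) :
    prabhakarKernel c r k σ x + c * prabhakarKernel c r k (σ + r) x
      = if k = 0 then rlKernel σ x else prabhakarKernel c r (k - 1) σ x := by
  have hs : ∀ m : ℕ, ∀ σ : ℝ, 0 < σ → Summable fun j : ℕ =>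
      ((j + m).choose m : ℝ) * (-c) ^ j * rlKernel (σ + r * j) x := fun m σ hσ =>
    (dominatedSeries_prabhakar hr hl hc hσ m).summable hx
  have e2 : c * prabhakarKernel c r k (σ + r) x
      = -∑' j : ℕ, ((j + k).choose k : ℝ) * (-c) ^ (j + 1) * rlKernel (σ + r * (j + 1 : ℕ)) x := by
    rw [prabhakarKernel, ← tsum_mul_left, ← tsum_neg]
    refine tsum_congr fun j => ?_
    rw [show σ + r + r * j = σ + r * (j + 1 : ℕ) by push_cast; ring]
    ring
  have hs2 : Summable fun j : ℕ =>
      ((j + k).choose k : ℝ) * (-c) ^ (j + 1) * rlKernel (σ + r * (j + 1 : ℕ)) x := by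
    refine ((hs k (σ + r) (by positivity)).mul_left (-c)).congr fun j => ?_
    rw [show σ + r + r * j = σ + r * (j + 1 : ℕ) by push_cast; ring]
    ring
  have hs1 := hs k σ hσ
  rw [e2, prabhakarKernel, hs1.tsum_eq_zero_add, add_assoc, ← sub_eq_add_neg,
    ← ((summable_nat_add_iff 1).2 hs1).tsum_sub hs2]
  rcases k with _ | m
  · simp
  · rw [if_neg (Nat.succ_ne_zero m), Nat.add_sub_cancel, prabhakarKernel,
      (hs m σ hσ).tsum_eq_zero_add]
    congr 1
    · simp
    · refine tsum_congr fun j => ?_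
      have : ((j + 1 + (m + 1)).choose (m + 1) : ℝ)
          = (j + 1 + m).choose m + (j + (m + 1)).choose (m + 1) := by
        rw [show j + 1 + (m + 1) = (j + 1 + m) + 1 by ring, Nat.choose_succ_succ,
          show j + (m + 1) = j + 1 + m by ring]
        push_cast; ring
      rw [this]; ring

end Prabhakar

/-! ### Binomial combinations of shifts and the choice of the weight -/

/-- The standing assumptions on the orders and the leading coefficients. -/
structure AdmissibleOrders (μ a : Fin 3 → ℝ) : Prop where
  pos : 0 < μ 0
  le : μ 0 ≤ μ 1
  le' : μ 1 ≤ μ 2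
  lead : |(if μ 0 = μ 2 then a 0 else 0) + (if μ 1 = μ 2 then a 1 else 0)| < |a 2|

namespace AdmissibleOrders

variable {μ a : Fin 3 → ℝ}

lemma order_pos (h : AdmissibleOrders μ a) (j : Fin 3) : 0 < μ j := by
  have h0 := h.pos
  have h1 := h.le
  have h2 := h.le'
  fin_cases j <;> simp only [Fin.zero_eta, Fin.mk_one, Fin.reduceFinMk] <;> linarith

lemma order_le (h : AdmissibleOrders μ a) (j : Fin 3) : μ j ≤ μ 2 := by
  have h1 := h.le
  have h2 := h.le'
  fin_cases j <;> simp only [Fin.zero_eta, Fin.mk_one, Fin.reduceFinMk] <;> linarith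

lemma coeff_ne_zero (h : AdmissibleOrders μ a) : a 2 ≠ 0 :=
  abs_pos.1 ((abs_nonneg _).trans_lt h.lead)

end AdmissibleOrders

/-- The binomial combination `∑ᵢ C(k,i) a₁ⁱ a₂^{k-i} F((μ₃-μ₂)k + (μ₂-μ₁)i)`. -/
def threeTermSum (μ a : Fin 3 → ℝ) (k : ℕ) (F : ℝ → ℝ) : ℝ :=
  ∑ i ∈ Finset.range (k + 1), (Nat.choose k i : ℝ) * a 0 ^ i * a 1 ^ (k - i) *
    F ((μ 2 - μ 1) * k + (μ 1 - μ 0) * i)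

lemma threeTermSum_zero (μ a : Fin 3 → ℝ) (F : ℝ → ℝ) : threeTermSum μ a 0 F = F 0 := by
  simp [threeTermSum]

/-- The sum is the k-th power of the operator `a 1` T + `a 0` S, with T and S the shifts by μ 2 - μ
1 and μ 2 - μ 0, applied to F and evaluated at 0: the exponent equals (k - i)(μ 2 - μ 1) + i (μ 2 -
μ 0). Splitting off one factor is Pascal's rule. -/
lemma threeTermSum_succ (μ a : Fin 3 → ℝ) (k : ℕ) (F : ℝ → ℝ) :
    threeTermSum μ a (k + 1) F = a 1 * threeTermSum μ a k (fun τ => F (τ + (μ 2 - μ 1)))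
      + a 0 * threeTermSum μ a k (fun τ => F (τ + (μ 2 - μ 0))) := by
  have h := Finset.sum_choose_succ_mul (fun i j => a 0 ^ i * a 1 ^ j *
    F ((μ 2 - μ 1) * (i + j) + (μ 1 - μ 0) * i)) k
  have hl : ∀ i ∈ Finset.range (k + 1), ((k - i : ℕ) : ℝ) = k - i := fun i hi => by
    rw [Nat.cast_sub (by simpa [Nat.lt_succ_iff] using hi)]
  have hl' : ∀ i ∈ Finset.range (k + 1), k + 1 - i = (k - i) + 1 := fun i hi => by
    have : i ≤ k := by simpa [Nat.lt_succ_iff] using hi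
    omega
  unfold threeTermSum
  calc _ = _ := Finset.sum_congr rfl fun i hi => by
        have : i ≤ k + 1 := by simpa [Nat.lt_succ_iff] using hi
        rw [show ((k + 1 : ℕ) : ℝ) = (i : ℝ) + (k + 1 - i : ℕ) by
          rw [Nat.cast_sub this]; push_cast; ring]
        simp only [mul_assoc]
    _ = _ := h
    _ = _ := by
      rw [Finset.mul_sum, Finset.mul_sum]
      congr 1
      · refine Finset.sum_congr rfl fun i hi => ?_
        rw [hl' i hi]
        push_cast
        rw [hl i hi, pow_succ]
        rw [show (μ 2 - μ 1) * (i + (k - i + 1)) + (μ 1 - μ 0) * i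
          = (μ 2 - μ 1) * k + (μ 1 - μ 0) * i + (μ 2 - μ 1) by ring]
        ring
      · refine Finset.sum_congr rfl fun i hi => ?_
        rw [hl i hi, pow_succ]
        push_cast
        rw [show (μ 2 - μ 1) * (i + 1 + (k - i)) + (μ 1 - μ 0) * (i + 1)
          = (μ 2 - μ 1) * k + (μ 1 - μ 0) * i + (μ 2 - μ 0) by ring]
        ring

lemma threeTermSum_add_mul (μ a : Fin 3 → ℝ) (k : ℕ) (F G : ℝ → ℝ) (c : ℝ) :
    threeTermSum μ a k (fun τ => F τ + c * G τ)
      = threeTermSum μ a k F + c * threeTermSum μ a k G := by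
  unfold threeTermSum
  rw [Finset.mul_sum, ← Finset.sum_add_distrib]
  exact Finset.sum_congr rfl fun i _ => by ring

lemma AdmissibleOrders.shift_nonneg {μ a : Fin 3 → ℝ} (h : AdmissibleOrders μ a) (k i : ℕ) :
    0 ≤ (μ 2 - μ 1) * k + (μ 1 - μ 0) * i :=
  add_nonneg (mul_nonneg (sub_nonneg.2 h.le') (Nat.cast_nonneg _))
    (mul_nonneg (sub_nonneg.2 h.le) (Nat.cast_nonneg _))

lemma threeTermSum_congr {μ a : Fin 3 → ℝ} (h : AdmissibleOrders μ a) (k : ℕ) {F G : ℝ → ℝ}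
    (H : ∀ τ, 0 ≤ τ → F τ = G τ) : threeTermSum μ a k F = threeTermSum μ a k G :=
  Finset.sum_congr rfl fun i _ => by rw [H _ (h.shift_nonneg k i)]

lemma tendsto_rpow_neg_atTop' {y : ℝ} (hy : 0 ≤ y) :
    Tendsto (fun l : ℝ => l ^ (-y)) atTop (𝓝 (if y = 0 then 1 else 0)) := by
  split_ifs with h
  · simp [h]
  · exact tendsto_rpow_neg_atTop (lt_of_le_of_ne hy (Ne.symm h))

/-- A shift by s replaces the bound B l^(-τ) by (B l^(-s)) l^(-τ), so each factor of the operator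
power costs the sum of its two weighted coefficients. -/
lemma abs_threeTermSum_le_of_shift {μ a : Fin 3 → ℝ} {l : ℝ} (hl : 0 < l)
    (hq : 0 ≤ μ 2 - μ 1) (hp : 0 ≤ μ 2 - μ 0) (k : ℕ) :
    ∀ (F : ℝ → ℝ) (B : ℝ), (∀ τ, 0 ≤ τ → |F τ| ≤ B * l ^ (-τ)) → |threeTermSum μ a k F| ≤
      B * (|a 1| * l ^ (-(μ 2 - μ 1)) + |a 0| * l ^ (-(μ 2 - μ 0))) ^ k := by
  induction k with
  | zero => intro F B h; simpa [threeTermSum_zero] using h 0 le_rfl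
  | succ k ih =>
    intro F B h
    have hs : ∀ s, 0 ≤ s → |threeTermSum μ a k (fun τ => F (τ + s))| ≤ B * l ^ (-s) *
        (|a 1| * l ^ (-(μ 2 - μ 1)) + |a 0| * l ^ (-(μ 2 - μ 0))) ^ k := fun s hs =>
      ih _ _ fun τ hτ => (h (τ + s) (by positivity)).trans_eq (by
        rw [mul_assoc, ← Real.rpow_add hl]; congr 2; ring)
    rw [threeTermSum_succ]
    refine (abs_add_le _ _).trans ?_
    rw [abs_mul, abs_mul, pow_succ]
    have h1 := mul_le_mul_of_nonneg_left (hs _ hq) (abs_nonneg (a 1))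
    have h2 := mul_le_mul_of_nonneg_left (hs _ hp) (abs_nonneg (a 0))
    linarith

/-- With equal orders both shifts are trivial, and the sum is (a 0 + a 1)^k F 0. This keeps the
cancellation between the two coefficients, which the estimate by shifts would lose. -/
lemma abs_threeTermSum_le_of_eq {μ a : Fin 3 → ℝ} (hq : μ 2 - μ 1 = 0) (hp : μ 2 - μ 0 = 0)
    (k : ℕ) : ∀ (F : ℝ → ℝ) (B : ℝ), |F 0| ≤ B → |threeTermSum μ a k F| ≤ B * |a 0 + a 1| ^ k := by
  induction k with
  | zero => intro F B h; simpa [threeTermSum_zero] using h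
  | succ k ih =>
    intro F B h
    rw [threeTermSum_succ]
    simp only [hq, hp, add_zero]
    rw [← add_mul, abs_mul, pow_succ, add_comm (a 1)]
    have := mul_le_mul_of_nonneg_left (ih F B h) (abs_nonneg (a 0 + a 1))
    linarith

/-- A weight `l` for which the binomial combinations grow slower than `(|a₃| (1 - |c| l^{-r}))^k`. -/
lemma AdmissibleOrders.exists_weight {μ a : Fin 3 → ℝ} (h : AdmissibleOrders μ a) (c : ℝ) :
    ∃ l θ : ℝ, 0 < l ∧ 0 ≤ θ ∧ |c| * l ^ (-μ 2) < 1 ∧ θ < |a 2| * (1 - |c| * l ^ (-μ 2)) ∧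
      ∀ (k : ℕ) (F : ℝ → ℝ) (B : ℝ), (∀ τ, 0 ≤ τ → |F τ| ≤ B * l ^ (-τ)) →
        |threeTermSum μ a k F| ≤ B * θ ^ k := by
  have hr : Tendsto (fun l : ℝ => |c| * l ^ (-μ 2)) atTop (𝓝 0) := by
    simpa using (tendsto_rpow_neg_atTop (h.order_pos 2)).const_mul |c|
  have hδ : Tendsto (fun l : ℝ => |a 2| * (1 - |c| * l ^ (-μ 2))) atTop (𝓝 |a 2|) := by
    simpa using (hr.const_sub 1).const_mul |a 2|
  have hlead := h.lead
  by_cases h0 : μ 0 = μ 2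
  · have h1 : μ 1 = μ 2 := le_antisymm h.le' (h0 ▸ h.le)
    rw [if_pos h0, if_pos h1] at hlead
    obtain ⟨l, hl0, hl1, hl2⟩ := ((eventually_gt_atTop 0).and
      ((hr.eventually_lt_const one_pos).and (hδ.eventually_const_lt hlead))).exists
    refine ⟨l, _, hl0, abs_nonneg _, hl1, hl2, fun k F B hF => ?_⟩
    exact abs_threeTermSum_le_of_eq (by rw [h1, sub_self]) (by rw [h0, sub_self]) k F B
      (by simpa using hF 0 le_rfl)
  -- Here the order μ 0 is strictly below μ 2, so as l → ∞ at most `a 1` survives, and the triangle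
  -- inequality costs nothing in the limit.
  · have hq : 0 ≤ μ 2 - μ 1 := sub_nonneg.2 h.le'
    have hp : 0 < μ 2 - μ 0 := sub_pos.2 (lt_of_le_of_ne (h.order_le 0) h0)
    have hθ : Tendsto (fun l : ℝ => |a 1| * l ^ (-(μ 2 - μ 1)) + |a 0| * l ^ (-(μ 2 - μ 0)))
        atTop (𝓝 (|a 1| * (if μ 2 - μ 1 = 0 then 1 else 0) + |a 0| * 0)) :=
      ((tendsto_rpow_neg_atTop' hq).const_mul _).add ((tendsto_rpow_neg_atTop hp).const_mul _)
    have hlt : |a 1| * (if μ 2 - μ 1 = 0 then 1 else 0) + |a 0| * 0 < |a 2| := by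
      rw [if_neg h0, zero_add] at hlead
      simp only [sub_eq_zero, eq_comm (a := μ 2)]
      split_ifs at hlead ⊢
      · simpa using hlead
      · simpa using hlead
    obtain ⟨l, hl0, hl1, hl2⟩ := ((eventually_gt_atTop 0).and
      ((hr.eventually_lt_const one_pos).and (hθ.eventually_lt hδ hlt))).exists
    exact ⟨l, _, hl0, by positivity, hl1, hl2, abs_threeTermSum_le_of_shift hl0 hq hp.le⟩

/-! ### The resolvent kernels and the resolvent equation -/

/-- The `k`-th term of the resolvent series applied to the Riemann–Liouville kernel of
order `σ`. -/
def resolventTerm (μ a : Fin 3 → ℝ) (a₄ σ : ℝ) (k : ℕ) (x : ℝ) : ℝ :=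
  (-1) ^ k / a 2 ^ (k + 1) *
    threeTermSum μ a k fun τ => prabhakarKernel (a₄ / a 2) (μ 2) k (σ + τ) x

/-- The solution of `∑ⱼ aⱼ I^{μ₃-μⱼ} u + a₄ I^{μ₃} u = x^{σ-1} / Γ(σ)`. -/
def resolventKernel (μ a : Fin 3 → ℝ) (a₄ σ x : ℝ) : ℝ := ∑' k : ℕ, resolventTerm μ a a₄ σ k x

section Resolvent

variable {μ a : Fin 3 → ℝ}

lemma continuousOn_threeTermSum (k : ℕ) {F : ℝ → ℝ → ℝ} {s : Set ℝ}
    (hF : ∀ i, i ≤ k → ContinuousOn (F ((μ 2 - μ 1) * k + (μ 1 - μ 0) * i)) s) :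
    ContinuousOn (fun x => threeTermSum μ a k fun τ => F τ x) s :=
  continuousOn_finsetSum _ fun i hi =>
    (hF i (by simpa [Nat.lt_succ_iff] using hi)).const_mul _

/-- The factors |a 2|^{-(k+1)} from the prefactor, δ^{-(k+1)} from the negative binomial series and
θ^k from the shifts combine to a geometric series of ratio θ / (|a 2| δ), which the weight makes
smaller than 1. -/
lemma dominatedSeries_resolvent (h : AdmissibleOrders μ a) (a₄ : ℝ) {σ : ℝ} (hσ : 0 < σ) :
    DominatedSeries σ (resolventTerm μ a a₄ σ) := by
  obtain ⟨l, θ, hl, hθ, hc, hθlt, hA⟩ := h.exists_weight (a₄ / a 2)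
  have hr := (h.order_pos 2).le
  set δ := 1 - |a₄ / a 2| * l ^ (-μ 2) with hδ
  have hδ0 : 0 < δ := by linarith
  have ha : 0 < |a 2| := abs_pos.2 h.coeff_ne_zero
  refine ⟨fun k => (continuousOn_threeTermSum k fun i _ =>
    (volterraContinuous_prabhakarKernel hr hl hc
      (add_pos_of_pos_of_nonneg hσ (h.shift_nonneg k i)) k).cont).const_mul _, fun X hX => ?_⟩
  refine ⟨fun k => rlBound (l * X) / (|a 2| * δ) * (θ / (|a 2| * δ)) ^ k,
    (summable_geometric_of_lt_one (by positivity)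
      ((div_lt_one (by positivity)).2 hθlt)).mul_left _, fun k x hx => ?_⟩
  have key := hA k (fun τ => prabhakarKernel (a₄ / a 2) (μ 2) k (σ + τ) x)
    (rlBound (l * X) * x ^ (σ - 1) * (1 / δ ^ (k + 1))) fun τ hτ =>
      (abs_prabhakarKernel_le hr hl hc hσ hτ hx k).trans_eq (by rw [← hδ]; ring)
  rw [resolventTerm, abs_mul, abs_div, abs_pow, abs_neg, abs_one, one_pow, abs_pow]
  calc _ ≤ 1 / |a 2| ^ (k + 1) * (rlBound (l * X) * x ^ (σ - 1) * (1 / δ ^ (k + 1)) * θ ^ k) := by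
        gcongr
    _ = _ := by simp only [div_pow, mul_pow]; field_simp; ring

lemma volterraContinuous_resolventKernel (h : AdmissibleOrders μ a) (a₄ : ℝ) {σ : ℝ}
    (hσ : 0 < σ) : VolterraContinuous (resolventKernel μ a a₄ σ) :=
  (dominatedSeries_resolvent h a₄ hσ).volterraContinuous_tsum hσ

lemma boundedNearZero_resolventKernel (h : AdmissibleOrders μ a) (a₄ : ℝ) {σ : ℝ}
    (hσ : 1 ≤ σ) : BoundedNearZero (resolventKernel μ a a₄ σ) := by
  have hσ0 : 0 < σ := by linarith
  intro X
  rcases le_or_gt X 0 with hX | hX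
  · exact ⟨0, fun x hx => absurd hx.1 (by linarith [hx.2])⟩
  obtain ⟨C, hC⟩ := (dominatedSeries_resolvent h a₄ hσ0).tsum_le hX
  refine ⟨|C| * X ^ (σ - 1), fun x hx => (hC x hx).trans ?_⟩
  have := Real.rpow_le_rpow hx.1.le hx.2 (sub_nonneg.2 hσ)
  have := Real.rpow_nonneg hx.1.le (σ - 1)
  gcongr
  exact le_abs_self C

lemma resolventTerm_vconv (h : AdmissibleOrders μ a) (a₄ : ℝ) {σ s x : ℝ} (hσ : 0 < σ)
    (hs : 0 < s) (hx : 0 < x) (k : ℕ) :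
    vconv (resolventTerm μ a a₄ σ k) (rlKernel s) x = resolventTerm μ a a₄ (σ + s) k x := by
  obtain ⟨l, θ, hl, -, hc, -⟩ := h.exists_weight (a₄ / a 2)
  have hr := (h.order_pos 2).le
  have hpos : ∀ i : ℕ, 0 < σ + ((μ 2 - μ 1) * k + (μ 1 - μ 0) * i) := fun i =>
    add_pos_of_pos_of_nonneg hσ (h.shift_nonneg k i)
  have hV := fun i : ℕ => volterraContinuous_prabhakarKernel hr hl hc (hpos i) k
  rw [vconv_comm]
  change vconv _ (fun y => _ / _ * ∑ i ∈ _, _) _ = _ / _ * ∑ i ∈ _, _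
  rw [vconv_const_mul_right, vconv_sum_right]
  · congr 1
    refine Finset.sum_congr rfl fun i _ => ?_
    rw [vconv_const_mul_right, vconv_comm, vconv_prabhakarKernel hr hl hc (hpos i) hs hx]
    congr 2
    ring
  · intro i _
    have := ((volterraContinuous_rlKernel hs).bounded.integrable_mul (hV i).bounded
      hx).const_mul ((Nat.choose k i : ℝ) * a 0 ^ i * a 1 ^ (k - i))
    refine intervalIntegrable_congr_Ioo hx.le (fun u _ => ?_) this
    ring

/-- `I^s` shifts the index of the resolvent kernels. -/
lemma resolventKernel_vconv (h : AdmissibleOrders μ a) (a₄ : ℝ) {σ s x : ℝ} (hσ : 0 < σ)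
    (hs : 0 < s) (hx : 0 < x) :
    vconv (resolventKernel μ a a₄ σ) (rlKernel s) x = resolventKernel μ a a₄ (σ + s) x := by
  have := ((dominatedSeries_resolvent h a₄ hσ).hasSum_vconv hσ
    (volterraContinuous_rlKernel hs).bounded hx).tsum_eq
  change vconv (fun y => ∑' k, _) _ _ = _
  rw [← this]
  exact tsum_congr fun k => resolventTerm_vconv h a₄ hσ hs hx k

/-- Applying a 2 + a₄ I^{μ 2} to the k-th term removes one Prabhakar factor; what remains is minus
the lower-order operator a 1 I^{μ 2 - μ 1} + a 0 I^{μ 2 - μ 0} applied to the previous term.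
Summation over k then yields the resolvent equation. -/
lemma resolventTerm_rec (h : AdmissibleOrders μ a) (a₄ : ℝ) {σ x : ℝ} (hσ : 0 < σ)
    (hx : 0 < x) (k : ℕ) :
    a 2 * resolventTerm μ a a₄ σ k x + a₄ * resolventTerm μ a a₄ (σ + μ 2) k x
      = if k = 0 then rlKernel σ x else
        -(a 1 * resolventTerm μ a a₄ (σ + (μ 2 - μ 1)) (k - 1) x
          + a 0 * resolventTerm μ a a₄ (σ + (μ 2 - μ 0)) (k - 1) x) := by
  obtain ⟨l, θ, hl, -, hc, -⟩ := h.exists_weight (a₄ / a 2)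
  have hr := (h.order_pos 2).le
  have ha := h.coeff_ne_zero
  have e : a 2 * resolventTerm μ a a₄ σ k x + a₄ * resolventTerm μ a a₄ (σ + μ 2) k x
      = (-1) ^ k / a 2 ^ k * threeTermSum μ a k (fun τ =>
        prabhakarKernel (a₄ / a 2) (μ 2) k (σ + τ) x
          + a₄ / a 2 * prabhakarKernel (a₄ / a 2) (μ 2) k (σ + μ 2 + τ) x) := by
    rw [threeTermSum_add_mul, resolventTerm, resolventTerm, pow_succ]
    field_simp
  rw [e, threeTermSum_congr h k (G := fun τ => if k = 0 then rlKernel (σ + τ) x else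
    prabhakarKernel (a₄ / a 2) (μ 2) (k - 1) (σ + τ) x) fun τ hτ => by
      rw [← prabhakarKernel_add hr hl hc (by positivity) hx k, add_right_comm]]
  rcases k with _ | k
  · simp [threeTermSum_zero]
  · simp only [Nat.succ_ne_zero, if_false, Nat.add_sub_cancel]
    rw [threeTermSum_succ, resolventTerm, resolventTerm]
    simp only [add_assoc, add_comm (μ 2 - _) _, pow_succ]
    ring

/-- The resolvent equation. -/
lemma resolventKernel_eq (h : AdmissibleOrders μ a) (a₄ : ℝ) {σ x : ℝ} (hσ : 0 < σ)
    (hx : 0 < x) :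
    (∑ j, a j * resolventKernel μ a a₄ (σ + (μ 2 - μ j)) x)
      + a₄ * resolventKernel μ a a₄ (σ + μ 2) x = rlKernel σ x := by
  have hs : ∀ σ, 0 < σ → Summable fun k => resolventTerm μ a a₄ σ k x := fun σ hσ =>
    (dominatedSeries_resolvent h a₄ hσ).summable hx
  have hq : 0 < σ + (μ 2 - μ 1) := by linarith [h.le']
  have hp : 0 < σ + (μ 2 - μ 0) := by linarith [h.order_le 0]
  have hr : 0 < σ + μ 2 := by linarith [h.order_pos 2]
  have hsum := ((hs σ hσ).mul_left (a 2)).add ((hs _ hr).mul_left a₄)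
  have h1 := hsum.tsum_eq_zero_add
  rw [((hs σ hσ).mul_left (a 2)).tsum_add ((hs _ hr).mul_left a₄), tsum_mul_left,
    tsum_mul_left] at h1
  simp only [resolventTerm_rec h a₄ hσ hx, Nat.succ_ne_zero, if_true, if_false,
    Nat.add_sub_cancel] at h1
  rw [tsum_neg, ((hs _ hq).mul_left (a 1)).tsum_add ((hs _ hp).mul_left (a 0)), tsum_mul_left,
    tsum_mul_left] at h1
  simp only [Fin.sum_univ_three, resolventKernel, sub_self, add_zero]
  linarith

end Resolvent

/-! ### Riemann–Liouville integrals of resolvent kernels and convolutions -/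

/-- The Riemann–Liouville integral of order `s ≥ 0` with base point `0`. -/
def rlIntegral (s : ℝ) (g : ℝ → ℝ) (x : ℝ) : ℝ := if s = 0 then g x else vconv (rlKernel s) g x

lemma rlIntegral_congr {s : ℝ} {g g' : ℝ → ℝ} {x : ℝ} (hx : 0 < x)
    (H : ∀ u ∈ Ioc 0 x, g u = g' u) : rlIntegral s g x = rlIntegral s g' x := by
  unfold rlIntegral
  split_ifs
  · exact H x ⟨hx, le_rfl⟩
  · exact vconv_congr hx.le (fun _ _ => rfl) fun u hu => H u ⟨hu.1, hu.2.le⟩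

lemma rlIntegral_rlKernel {s σ x : ℝ} (hs : 0 ≤ s) (hσ : 0 < σ) (hx : 0 < x) :
    rlIntegral s (rlKernel σ) x = rlKernel (σ + s) x := by
  unfold rlIntegral
  split_ifs with h
  · rw [h, add_zero]
  · rw [vconv_rlKernel (lt_of_le_of_ne hs (Ne.symm h)) hσ hx, add_comm]

lemma rlIntegral_const_mul (s c : ℝ) (g : ℝ → ℝ) (x : ℝ) :
    rlIntegral s (fun u => c * g u) x = c * rlIntegral s g x := by
  unfold rlIntegral
  split_ifs
  · rfl
  · exact vconv_const_mul_right _ _ _ _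

lemma rlIntegral_add {s : ℝ} (hs : 0 ≤ s) {g g' : ℝ → ℝ} (hg : VolterraContinuous g)
    (hg' : VolterraContinuous g') {x : ℝ} (hx : 0 < x) :
    rlIntegral s (fun u => g u + g' u) x = rlIntegral s g x + rlIntegral s g' x := by
  unfold rlIntegral
  split_ifs with h
  · rfl
  · have hk := (volterraContinuous_rlKernel (lt_of_le_of_ne hs (Ne.symm h))).bounded
    exact vconv_add_right (hk.integrable_mul hg.bounded hx) (hk.integrable_mul hg'.bounded hx)

lemma IntegrableNearZero.rlIntegral {s : ℝ} (hs : 0 ≤ s) {g : ℝ → ℝ}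
    (hg : IntegrableNearZero g) : IntegrableNearZero (rlIntegral s g) := by
  by_cases h : s = 0
  · have : _root_.rlIntegral s g = g := funext fun x => if_pos h
    rwa [this]
  · have : _root_.rlIntegral s g = _root_.vconv (rlKernel s) g := funext fun x => if_neg h
    rw [this]
    exact (volterraContinuous_rlKernel (lt_of_le_of_ne hs (Ne.symm h))).int.vconv hg

lemma VolterraContinuous.add {g g' : ℝ → ℝ} (hg : VolterraContinuous g)
    (hg' : VolterraContinuous g') : VolterraContinuous fun x => g x + g' x :=
  ⟨fun X hX => (hg.int X hX).add (hg'.int X hX), hg.cont.add hg'.cont⟩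

lemma VolterraContinuous.const_mul {g : ℝ → ℝ} (hg : VolterraContinuous g) (c : ℝ) :
    VolterraContinuous fun x => c * g x :=
  ⟨fun X hX => (hg.int X hX).const_mul c, hg.cont.const_mul c⟩

lemma volterraContinuous_const (c : ℝ) : VolterraContinuous fun _ => c :=
  ⟨integrableNearZero_const c, continuousOn_const⟩

lemma VolterraContinuous.sum {ι : Type*} (S : Finset ι) {g : ι → ℝ → ℝ}
    (hg : ∀ i, VolterraContinuous (g i)) : VolterraContinuous fun x => ∑ i ∈ S, g i x := by
  classical
  induction S using Finset.induction_on with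
  | empty => simpa using volterraContinuous_const 0
  | insert i S hi ih => simpa [Finset.sum_insert hi] using (hg i).add ih

lemma tendsto_primitive_zero {g : ℝ → ℝ} (hg : IntegrableNearZero g) :
    Tendsto (vconv (fun _ => 1) g) (𝓝[>] 0) (𝓝 0) := by
  refine squeeze_zero_norm' ?_ (tendsto_integral_abs_zero hg)
  filter_upwards [self_mem_nhdsWithin] with x hx
  rw [vconv_one]
  exact intervalIntegral.abs_integral_le_integral_abs (le_of_lt hx)

lemma rlKernel_one_eq : rlKernel 1 = fun _ => 1 := funext rlKernel_one

section Resolvent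

variable {μ a : Fin 3 → ℝ} (h : AdmissibleOrders μ a) (a₄ : ℝ)
include h

lemma rlIntegral_resolventKernel {s σ x : ℝ} (hs : 0 ≤ s) (hσ : 0 < σ) (hx : 0 < x) :
    rlIntegral s (resolventKernel μ a a₄ σ) x = resolventKernel μ a a₄ (σ + s) x := by
  unfold rlIntegral
  split_ifs with h0
  · rw [h0, add_zero]
  · rw [vconv_comm, resolventKernel_vconv h a₄ hσ (lt_of_le_of_ne hs (Ne.symm h0)) hx]

/-- The function `w` is only integrable near zero, possibly unbounded away from it; the index σ ≥ 1
provides the bounded outer kernel on which associativity then relies. For smaller σ,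
`rlIntegral_vconv_resolventKernel` asks for continuity of `w` instead. -/
lemma vconv_resolventKernel_rlIntegral {σ s : ℝ} (hσ : 1 ≤ σ) (hs : 0 ≤ s) {w : ℝ → ℝ}
    (hw : IntegrableNearZero w) {x : ℝ} (hx : 0 < x) :
    vconv (resolventKernel μ a a₄ σ) (rlIntegral s w) x
      = vconv (resolventKernel μ a a₄ (σ + s)) w x := by
  have hσ0 : 0 < σ := by linarith
  by_cases h0 : s = 0
  · rw [h0, add_zero]
    exact vconv_congr hx.le (fun _ _ => rfl) fun u _ => if_pos rfl
  · have hs0 := lt_of_le_of_ne hs (Ne.symm h0)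
    have e : rlIntegral s w = vconv (rlKernel s) w := funext fun x => if_neg h0
    rw [e, vconv_assoc_of_bounded (boundedNearZero_resolventKernel h a₄ hσ)
      (volterraContinuous_resolventKernel h a₄ hσ0).int (volterraContinuous_rlKernel hs0).int hw hx]
    exact vconv_congr hx.le (fun u hu => resolventKernel_vconv h a₄ hσ0 hs0 hu.1) fun _ _ => rfl

lemma rlIntegral_vconv_resolventKernel {σ s : ℝ} (hσ : 0 < σ) (hs : 0 ≤ s) {w : ℝ → ℝ}
    (hw : VolterraContinuous w) {x : ℝ} (hx : 0 < x) :
    rlIntegral s (vconv (resolventKernel μ a a₄ σ) w) x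
      = vconv (resolventKernel μ a a₄ (σ + s)) w x := by
  unfold rlIntegral
  split_ifs with h0
  · rw [h0, add_zero]
  · have hs0 := lt_of_le_of_ne hs (Ne.symm h0)
    rw [vconv_assoc (volterraContinuous_rlKernel hs0)
      (volterraContinuous_resolventKernel h a₄ hσ) hw hx]
    refine vconv_congr hx.le (fun u hu => ?_) fun _ _ => rfl
    rw [vconv_comm, resolventKernel_vconv h a₄ hσ hs0 hu.1]

lemma resolventKernel_add_one {σ x : ℝ} (hσ : 0 < σ) (hx : 0 < x) :
    resolventKernel μ a a₄ (σ + 1) x = vconv (fun _ => 1) (resolventKernel μ a a₄ σ) x := by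
  rw [← resolventKernel_vconv h a₄ hσ one_pos hx, vconv_comm, rlKernel_one_eq]

/-- The resolvent equation, convolved with `w`. -/
lemma resolventKernel_eq_vconv {σ : ℝ} (hσ : 0 < σ) {w : ℝ → ℝ} (hw : VolterraBounded w) {x : ℝ}
    (hx : 0 < x) :
    (∑ j, a j * vconv (resolventKernel μ a a₄ (σ + (μ 2 - μ j))) w x)
      + a₄ * vconv (resolventKernel μ a a₄ (σ + μ 2)) w x = vconv (rlKernel σ) w x := by
  have hpos : ∀ j, 0 < σ + (μ 2 - μ j) := fun j => by linarith [h.order_le j]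
  have hr : 0 < σ + μ 2 := by linarith [h.order_pos 2]
  have hU : ∀ ρ, 0 < ρ → ∀ c : ℝ, VolterraContinuous fun y => c * resolventKernel μ a a₄ ρ y :=
    fun ρ hρ c => (volterraContinuous_resolventKernel h a₄ hρ).const_mul c
  have hS := VolterraContinuous.sum Finset.univ fun j => hU _ (hpos j) (a j)
  rw [vconv_comm (rlKernel σ), ← vconv_congr hx.le (fun _ _ => rfl)
    fun u hu => resolventKernel_eq h a₄ hσ hu.1, vconv_add_right
    (hw.integrable_mul hS.bounded hx) (hw.integrable_mul (hU _ hr a₄).bounded hx),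
    vconv_sum_right _ fun j _ => hw.integrable_mul (hU _ (hpos j) (a j)).bounded hx,
    vconv_const_mul_right, vconv_comm _ w]
  simp only [vconv_const_mul_right, vconv_comm _ w]

end Resolvent

/-! ### The transformed problem: uniqueness -/

/-- The explicit solution after the substitution `x = Ψ(t)`. -/
def threeTermSolution (μ a b κ : Fin 3 → ℝ) (a₄ : ℝ) (F : ℝ → ℝ) (x : ℝ) : ℝ :=
  (∑ j, a j * b j * resolventKernel μ a a₄ (μ 2 + κ j) x)
    + vconv (resolventKernel μ a a₄ (μ 2)) F x

lemma volterraContinuous_threeTermSolution {μ a : Fin 3 → ℝ} (h : AdmissibleOrders μ a)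
    (b : Fin 3 → ℝ) {κ : Fin 3 → ℝ} (hκ : ∀ j, 0 ≤ κ j) (a₄ : ℝ) {F : ℝ → ℝ}
    (hF : VolterraBounded F) : VolterraContinuous (threeTermSolution μ a b κ a₄ F) := by
  have hr := h.order_pos 2
  exact (VolterraContinuous.sum Finset.univ fun j => (volterraContinuous_resolventKernel h a₄
    (add_pos_of_pos_of_nonneg hr (hκ j))).const_mul (a j * b j)).add
    ((volterraContinuous_resolventKernel h a₄ hr).vconv hF)

lemma vconv_rlKernel_two {g : ℝ → ℝ} (hg : IntegrableNearZero g) {x : ℝ} (hx : 0 < x) :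
    vconv (rlKernel 2) g x = vconv (fun _ => 1) (vconv (fun _ => 1) g) x := by
  rw [vconv_assoc_of_bounded (boundedNearZero_const 1) (integrableNearZero_const 1)
    (integrableNearZero_const 1) hg hx]
  refine vconv_congr hx.le (fun u hu => ?_) fun _ _ => rfl
  have := vconv_rlKernel one_pos one_pos hu.1
  rw [rlKernel_one_eq, one_add_one_eq_two] at this
  exact this.symm

/-- Convolution with `rlKernel 2` is the double primitive, so two differentiations recover the
functions. Uniqueness is reduced in this way to an identity between convolutions with bounded
kernels. -/
lemma VolterraContinuous.eq_of_vconv_two_eq {g g' : ℝ → ℝ} (hg : VolterraContinuous g)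
    (hg' : VolterraContinuous g') {X : ℝ}
    (H : ∀ x ∈ Ioo 0 X, _root_.vconv (rlKernel 2) g x = _root_.vconv (rlKernel 2) g' x) :
    ∀ x ∈ Ioo 0 X, g x = g' x := by
  have h1 := volterraContinuous_const 1
  refine hg.eq_of_primitive_eq hg' ((h1.vconv hg.bounded).eq_of_primitive_eq
    (h1.vconv hg'.bounded) fun x hx => ?_)
  rw [← vconv_rlKernel_two hg.int hx.1, ← vconv_rlKernel_two hg'.int hx.1]
  exact H x hx

/-- Uniqueness after the substitution `x = Ψ(t)`. -/
theorem eq_threeTermSolution {μ a : Fin 3 → ℝ} (h : AdmissibleOrders μ a) {b κ s : Fin 3 → ℝ}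
    (hκ : ∀ j, 0 ≤ κ j) (hs : ∀ j, 0 ≤ s j) (hsum : ∀ j, μ j + κ j + s j = 1) {a₄ X : ℝ}
    {Y F : ℝ → ℝ} {w : Fin 3 → ℝ → ℝ} (hY : VolterraContinuous Y) (hF : VolterraBounded F)
    (hw : ∀ j, IntegrableNearZero (w j))
    (hW : ∀ j, ∀ x ∈ Ioo 0 X, rlIntegral (s j) Y x = b j + vconv (fun _ => 1) (w j) x)
    (heq : ∀ᵐ x : ℝ, x ∈ Ioo 0 X →
      (∑ j, a j * rlIntegral (κ j) (w j) x) + a₄ * Y x = F x) :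
    ∀ x ∈ Ioo 0 X, Y x = threeTermSolution μ a b κ a₄ F x := by
  have hr := h.order_pos 2
  have hS := volterraContinuous_threeTermSolution h b hκ a₄ hF
  refine hY.eq_of_vconv_two_eq hS fun x hx => ?_
  have hx0 : 0 < x := hx.1
  have hUb : ∀ ρ, 1 ≤ ρ → BoundedNearZero (resolventKernel μ a a₄ ρ) := fun ρ hρ =>
    boundedNearZero_resolventKernel h a₄ hρ
  have hUc : ∀ ρ, 0 < ρ → VolterraContinuous (resolventKernel μ a a₄ ρ) := fun ρ hρ =>
    volterraContinuous_resolventKernel h a₄ hρ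
  -- The shift by 2 leaves room to move one integration onto `w j`: the remaining kernel, of index μ
  -- 2 + κ j + 1 ≥ 1, is still bounded near zero, as associativity with a merely integrable `w j`
  -- requires.
  have hK1 : 1 ≤ μ 2 + 2 := by linarith
  have hK0 : 0 < μ 2 + 2 := by linarith
  -- the convolution of the equation with a bounded resolvent kernel
  have e1 : vconv (resolventKernel μ a a₄ (μ 2 + 2)) F x
      = (∑ j, a j * vconv (resolventKernel μ a a₄ (μ 2 + 2)) (rlIntegral (κ j) (w j)) x)
        + a₄ * vconv (resolventKernel μ a a₄ (μ 2 + 2)) Y x := by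
    have hj : ∀ j, IntervalIntegrable (fun u => resolventKernel μ a a₄ (μ 2 + 2) (x - u) *
        (a j * rlIntegral (κ j) (w j) u)) volume 0 x := fun j =>
      (hUb _ hK1).integrable_mul (hUc _ hK0).int
        (fun X hX => (((hw j).rlIntegral (hκ j)) X hX).const_mul (a j)) hx0
    have e2 : vconv (resolventKernel μ a a₄ (μ 2 + 2)) F x
        = vconv (resolventKernel μ a a₄ (μ 2 + 2))
          (fun u => (∑ j, a j * rlIntegral (κ j) (w j) u) + a₄ * Y u) x := by
      unfold vconv
      refine intervalIntegral.integral_congr_ae ?_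
      filter_upwards [heq] with u hu hux
      rw [uIoc_of_le hx0.le] at hux
      rw [hu ⟨hux.1, hux.2.trans_lt hx.2⟩]
    rw [e2, vconv_add_right, vconv_sum_right _ fun j _ => hj j, vconv_const_mul_right]
    · simp only [vconv_const_mul_right]
    · have := IntervalIntegrable.sum Finset.univ fun j _ => hj j
      refine intervalIntegrable_congr_Ioo hx0.le (fun u _ => ?_) this
      simp only [Finset.sum_apply, Finset.mul_sum]
    · exact (hUc _ hK0).bounded.integrable_mul (hY.const_mul a₄).bounded hx0
  -- One integration is split off to form ∫ w j = I^{s j} Y - b j; absorbing I^{s j} into the kernel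
  -- and using μ j + κ j + s j = 1 leaves the index 2 + (μ 2 - μ j).
  have e3 : ∀ j, vconv (resolventKernel μ a a₄ (μ 2 + 2)) (rlIntegral (κ j) (w j)) x
      = vconv (resolventKernel μ a a₄ (2 + (μ 2 - μ j))) Y x
        - b j * resolventKernel μ a a₄ (μ 2 + κ j + 2) x := by
    intro j
    have hρ1 : 1 ≤ μ 2 + κ j + 1 := by linarith [hκ j]
    have hρ0 : 0 < μ 2 + κ j + 1 := by linarith [hκ j]
    have c1 : ∀ u, 0 < u → resolventKernel μ a a₄ (μ 2 + 2 + κ j) u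
        = vconv (resolventKernel μ a a₄ (μ 2 + κ j + 1)) (fun _ => 1) u := fun u hu => by
      rw [vconv_comm, ← resolventKernel_add_one h a₄ hρ0 hu]; congr 1; ring
    have c2 : ∀ u ∈ Ioo 0 x, vconv (fun _ => 1) (w j) u
        = rlIntegral (s j) Y u + (-b j) * 1 := fun u hu => by
      rw [hW j u ⟨hu.1, hu.2.trans hx.2⟩]; ring
    rw [vconv_resolventKernel_rlIntegral h a₄ hK1 (hκ j) (hw j) hx0,
      vconv_congr hx0.le (fun u hu => c1 u hu.1) (fun _ _ => rfl),
      ← vconv_assoc_of_bounded (hUb _ hρ1) (hUc _ hρ0).int (integrableNearZero_const 1) (hw j) hx0,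
      vconv_congr hx0.le (fun _ _ => rfl) c2, vconv_add_right
        ((hUb _ hρ1).integrable_mul (hUc _ hρ0).int (hY.int.rlIntegral (hs j)) hx0)
        ((hUb _ hρ1).integrable_mul (hUc _ hρ0).int (integrableNearZero_const _) hx0),
      vconv_resolventKernel_rlIntegral h a₄ hρ1 (hs j) hY.int hx0,
      vconv_const_mul_right _ (fun _ => 1), ← c1 x hx0,
      show μ 2 + κ j + 1 + s j = 2 + (μ 2 - μ j) by linarith [hsum j],
      show μ 2 + 2 + κ j = μ 2 + κ j + 2 by ring]
    ring
  -- By the resolvent equation at σ = 2, all terms containing Y add up to its double primitive.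
  have e4 := resolventKernel_eq_vconv h a₄ two_pos hY.bounded hx0
  have h2 : 0 < (2 : ℝ) := two_pos
  have hh2 := volterraContinuous_rlKernel h2
  have hUj : ∀ j, VolterraContinuous fun x =>
      a j * b j * resolventKernel μ a a₄ (μ 2 + κ j) x := fun j =>
    (hUc _ (add_pos_of_pos_of_nonneg hr (hκ j))).const_mul _
  have hb2 : BoundedNearZero (rlKernel 2) := by
    intro Z
    refine ⟨Z, fun u hu => ?_⟩
    have : rlKernel 2 u = u := by
      rw [rlKernel, Real.Gamma_two]; norm_num
    rw [this, abs_of_pos hu.1]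
    exact hu.2
  -- the double primitive of the explicit solution
  have e5 : vconv (rlKernel 2) (threeTermSolution μ a b κ a₄ F) x
      = (∑ j, a j * b j * resolventKernel μ a a₄ (μ 2 + κ j + 2) x)
        + vconv (resolventKernel μ a a₄ (μ 2 + 2)) F x := by
    change vconv (rlKernel 2) (fun x => (∑ j, _) + _) x = _
    rw [vconv_add_right, vconv_sum_right]
    · congr 1
      · refine Finset.sum_congr rfl fun j _ => ?_
        rw [vconv_const_mul_right, vconv_comm, resolventKernel_vconv h a₄
          (add_pos_of_pos_of_nonneg hr (hκ j)) h2 hx0]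
      · rw [vconv_assoc_of_bounded hb2 hh2.int (hUc _ hr).int hF.int hx0]
        refine vconv_congr hx0.le (fun u hu => ?_) fun _ _ => rfl
        rw [vconv_comm, resolventKernel_vconv h a₄ hr h2 hu.1]
    · exact fun j _ => hh2.bounded.integrable_mul (hUj j).bounded hx0
    · exact hh2.bounded.integrable_mul (VolterraContinuous.sum Finset.univ hUj).bounded hx0
    · exact hh2.bounded.integrable_mul ((hUc _ hr).vconv hF).bounded hx0
  rw [e5, e1, ← e4]
  simp only [e3, Fin.sum_univ_three, add_comm (2 : ℝ) (μ 2)]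
  ring

/-! ### The transformed problem: existence for compatible data -/

/-- `w` is the derivative of the Riemann–Liouville integral of order `s` of `y`, whose initial
value is `b`, and `D` is the Riemann–Liouville integral of order `κ` of `w`. -/
structure HasHilferDerivative (s κ : ℝ) (y : ℝ → ℝ) (b : ℝ) (w D : ℝ → ℝ) : Prop where
  cont : VolterraContinuous y
  cont_deriv : VolterraContinuous w
  integral_eq : ∀ x, 0 < x → rlIntegral s y x = b + vconv (fun _ => 1) w x
  deriv_integral_eq : ∀ x, 0 < x → rlIntegral κ w x = D x

namespace HasHilferDerivative

variable {s κ b b' : ℝ} {y y' w w' D D' : ℝ → ℝ}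

lemma tendsto (H : HasHilferDerivative s κ y b w D) :
    Tendsto (rlIntegral s y) (𝓝[>] 0) (𝓝 b) := by
  have := (tendsto_primitive_zero H.cont_deriv.int).const_add b
  rw [add_zero] at this
  refine this.congr' ?_
  filter_upwards [self_mem_nhdsWithin] with x hx using (H.integral_eq x hx).symm

lemma hasDerivAt (H : HasHilferDerivative s κ y b w D) {x : ℝ} (hx : 0 < x) :
    HasDerivAt (rlIntegral s y) (w x) x := by
  refine ((H.cont_deriv.hasDerivAt_primitive hx).const_add b).congr_of_eventuallyEq ?_
  filter_upwards [Ioi_mem_nhds hx] with u hu using H.integral_eq u hu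

lemma add (hs : 0 ≤ s) (hκ : 0 ≤ κ) (H : HasHilferDerivative s κ y b w D)
    (H' : HasHilferDerivative s κ y' b' w' D') :
    HasHilferDerivative s κ (fun x => y x + y' x) (b + b') (fun x => w x + w' x)
      (fun x => D x + D' x) where
  cont := H.cont.add H'.cont
  cont_deriv := H.cont_deriv.add H'.cont_deriv
  integral_eq x hx := by
    have h1 := (volterraContinuous_const 1).bounded
    rw [rlIntegral_add hs H.cont H'.cont hx, H.integral_eq x hx, H'.integral_eq x hx,
      vconv_add_right (h1.integrable_mul H.cont_deriv.bounded hx)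
        (h1.integrable_mul H'.cont_deriv.bounded hx)]
    ring
  deriv_integral_eq x hx := by
    rw [rlIntegral_add hκ H.cont_deriv H'.cont_deriv hx, H.deriv_integral_eq x hx,
      H'.deriv_integral_eq x hx]

lemma const_mul (c : ℝ) (H : HasHilferDerivative s κ y b w D) :
    HasHilferDerivative s κ (fun x => c * y x) (c * b) (fun x => c * w x)
      (fun x => c * D x) where
  cont := H.cont.const_mul c
  cont_deriv := H.cont_deriv.const_mul c
  integral_eq x hx := by
    rw [rlIntegral_const_mul, H.integral_eq x hx, vconv_const_mul_right]
    ring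
  deriv_integral_eq x hx := by rw [rlIntegral_const_mul, H.deriv_integral_eq x hx]

lemma congr (H : HasHilferDerivative s κ y b w D) (hy : ∀ x, 0 < x → y' x = y x) (hb : b = b')
    (hD : ∀ x, 0 < x → D x = D' x) : HasHilferDerivative s κ y' b' w D' where
  cont := ⟨fun X hX => intervalIntegrable_congr_Ioo hX.le (fun u hu => (hy u hu.1).symm)
    (H.cont.int X hX), H.cont.cont.congr fun u hu => hy u hu⟩
  cont_deriv := H.cont_deriv
  integral_eq x hx := by
    rw [rlIntegral_congr hx fun u hu => hy u hu.1, H.integral_eq x hx, hb]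
  deriv_integral_eq x hx := by rw [H.deriv_integral_eq x hx, hD x hx]

end HasHilferDerivative

lemma hasHilferDerivative_zero (s κ : ℝ) :
    HasHilferDerivative s κ (fun _ => 0) 0 (fun _ => 0) (fun _ => 0) where
  cont := volterraContinuous_const 0
  cont_deriv := volterraContinuous_const 0
  integral_eq x _ := by simp [rlIntegral, vconv]
  deriv_integral_eq x _ := by simp [rlIntegral, vconv]

lemma HasHilferDerivative.sum {s κ : ℝ} (hs : 0 ≤ s) (hκ : 0 ≤ κ) {ι : Type*} (S : Finset ι)
    {y w D : ι → ℝ → ℝ} {b : ι → ℝ} (H : ∀ i, HasHilferDerivative s κ (y i) (b i) (w i) (D i)) :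
    HasHilferDerivative s κ (fun x => ∑ i ∈ S, y i x) (∑ i ∈ S, b i) (fun x => ∑ i ∈ S, w i x)
      (fun x => ∑ i ∈ S, D i x) := by
  classical
  induction S using Finset.induction_on with
  | empty => simpa using hasHilferDerivative_zero s κ
  | insert i S hi ih => simpa [Finset.sum_insert hi] using (H i).add hs hκ ih

section Pieces

variable {m κ s : ℝ}

/-- I^s maps h_g to h_{g+s}, which is the constant 1 exactly if g = m + κ, and otherwise the
primitive of h_{g-(m+κ)} vanishing at zero. Such a power is the only piece of the solution with a
nonzero initial value. -/
lemma hasHilferDerivative_rlKernel (hκ : 0 ≤ κ) (hs : 0 ≤ s) (hm : 0 < m)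
    (hsum : m + κ + s = 1) {g : ℝ} (hg : m + κ ≤ g) :
    HasHilferDerivative s κ (rlKernel g) (if m + κ = g then 1 else 0)
      (fun x => if m + κ = g then 0 else rlKernel (g - (m + κ)) x)
      (fun x => if m + κ = g then 0 else rlKernel (g - m) x) := by
  have hg0 : 0 < g := by linarith
  split_ifs with h
  · refine ⟨volterraContinuous_rlKernel hg0, volterraContinuous_const 0, fun x hx => ?_,
      fun x _ => by simp [rlIntegral, vconv]⟩
    rw [rlIntegral_rlKernel hs hg0 hx, ← h, hsum, rlKernel_one]
    simp [vconv]
  · have hlt : 0 < g - (m + κ) := sub_pos.2 (lt_of_le_of_ne hg h)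
    refine ⟨volterraContinuous_rlKernel hg0, volterraContinuous_rlKernel hlt, fun x hx => ?_,
      fun x hx => ?_⟩
    · rw [rlIntegral_rlKernel hs hg0 hx, zero_add, ← rlKernel_one_eq,
        vconv_rlKernel one_pos hlt hx]
      congr 1; linarith
    · rw [rlIntegral_rlKernel hκ hlt hx]
      congr 1; linarith

variable {μ a : Fin 3 → ℝ} (h : AdmissibleOrders μ a) (a₄ : ℝ)
include h

/-- The strict inequality gives the derivative the positive index σ - (m + κ), hence integrability
at zero, and forces the initial value 0. Both integrals are instances of the index shift. -/
lemma hasHilferDerivative_resolventKernel (hκ : 0 ≤ κ) (hs : 0 ≤ s) (hm : 0 < m)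
    (hsum : m + κ + s = 1) {σ : ℝ} (hσ : m + κ < σ) :
    HasHilferDerivative s κ (resolventKernel μ a a₄ σ) 0 (resolventKernel μ a a₄ (σ - (m + κ)))
      (resolventKernel μ a a₄ (σ - m)) := by
  have hσ0 : 0 < σ := by linarith
  have hlt : 0 < σ - (m + κ) := sub_pos.2 hσ
  refine ⟨volterraContinuous_resolventKernel h a₄ hσ0, volterraContinuous_resolventKernel h a₄ hlt,
    fun x hx => ?_, fun x hx => ?_⟩
  · rw [rlIntegral_resolventKernel h a₄ hs hσ0 hx, zero_add,
      ← resolventKernel_add_one h a₄ hlt hx]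
    congr 1; linarith
  · rw [rlIntegral_resolventKernel h a₄ hκ hlt hx]
    congr 1; linarith

lemma hasHilferDerivative_vconv (hκ : 0 ≤ κ) (hs : 0 ≤ s) (hm : 0 < m)
    (hsum : m + κ + s = 1) {σ : ℝ} (hσ : m + κ < σ) {φ : ℝ → ℝ} (hφ : VolterraContinuous φ) :
    HasHilferDerivative s κ (vconv (resolventKernel μ a a₄ σ) φ) 0
      (vconv (resolventKernel μ a a₄ (σ - (m + κ))) φ)
      (vconv (resolventKernel μ a a₄ (σ - m)) φ) := by
  have hσ0 : 0 < σ := by linarith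
  have hlt : 0 < σ - (m + κ) := sub_pos.2 hσ
  have hU := volterraContinuous_resolventKernel h a₄ hσ0
  have hU' := volterraContinuous_resolventKernel h a₄ hlt
  refine ⟨hU.vconv hφ.bounded, hU'.vconv hφ.bounded, fun x hx => ?_, fun x hx => ?_⟩
  · rw [rlIntegral_vconv_resolventKernel h a₄ hσ0 hs hφ hx, zero_add,
      vconv_assoc (volterraContinuous_const 1) hU' hφ hx]
    refine vconv_congr hx.le (fun u hu => ?_) fun _ _ => rfl
    rw [← resolventKernel_add_one h a₄ hlt hu.1]
    congr 1; linarith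
  · rw [rlIntegral_vconv_resolventKernel h a₄ hlt hκ hφ hx]
    congr 2; linarith

end Pieces

/-- Existence after the substitution `x = Ψ(t)`. -/
theorem exists_hasHilferDerivative_threeTermSolution {μ a : Fin 3 → ℝ} (h : AdmissibleOrders μ a)
    {b κ s : Fin 3 → ℝ} (hκ : ∀ j, 0 ≤ κ j) (hs : ∀ j, 0 ≤ s j)
    (hsum : ∀ j, μ j + κ j + s j = 1) (a₄ : ℝ) {β g F₀ : ℝ} {F φ : ℝ → ℝ}
    (hg : ∀ j, μ j + κ j ≤ g) (hb : ∀ j, b j = if μ j + κ j = g then β else 0)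
    (hβ : β ≠ 0 → ∑ j, (if μ j = μ 2 ∧ μ j + κ j < g then a j else 0) = 0)
    (hφ : VolterraContinuous φ) (hF : ∀ x, 0 < x → F x = F₀ + vconv (fun _ => 1) φ x) :
    ∃ w D : Fin 3 → ℝ → ℝ,
      (∀ j, HasHilferDerivative (s j) (κ j) (threeTermSolution μ a b κ a₄ F) (b j) (w j) (D j)) ∧
      ∀ x, 0 < x → (∑ j, a j * D j x) + a₄ * threeTermSolution μ a b κ a₄ F x = F x := by
  have hμ := h.order_pos
  have hr := hμ 2
  have hle := h.order_le
  have hg0 : 0 < g := by linarith [hg 2, hκ 2]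
  have hγ1 : ∀ j, μ j + κ j ≤ 1 := fun j => by linarith [hsum j, hs j]
  -- `c` collects the coefficients with γ_l < g and order below μ 2, and `e` the indices of their
  -- resolvent kernels. Where `c l` vanishes, `e l` is a dummy value chosen so that e l > g and e l
  -- > μ 2 hold for all l.
  set c : Fin 3 → ℝ := fun l => if μ l + κ l < g ∧ μ l < μ 2 then a l else 0 with hc
  set e : Fin 3 → ℝ := fun l => if μ l + κ l < g ∧ μ l < μ 2 then g + (μ 2 - μ l) else g + μ 2
    with he
  have heg : ∀ l, g < e l := fun l => by
    simp only [he]; split_ifs with H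
    · linarith [H.2]
    · linarith
  have her : ∀ l, 0 < e l - μ 2 := fun l => by
    simp only [he]; split_ifs with H
    · linarith [H.1, hκ l]
    · linarith
  have hβ' : β * ∑ j, (if μ j = μ 2 ∧ μ j + κ j < g then a j else 0) = 0 := by
    by_cases h0 : β = 0
    · rw [h0, zero_mul]
    · rw [hβ h0, mul_zero]
  -- every index with `γ_j < g` contributes to `c` or to the cancelling terms of highest order
  have hsplit : ∀ (G : ℝ → ℝ),
      β * ∑ j, (if μ j + κ j < g then a j * G (μ 2 - μ j) else 0)
        = β * ∑ j, (if μ j + κ j < g ∧ μ j < μ 2 then a j * G (μ 2 - μ j) else 0) := by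
    intro G
    have : ∑ j, (if μ j + κ j < g then a j * G (μ 2 - μ j) else 0)
        = ∑ j, (if μ j + κ j < g ∧ μ j < μ 2 then a j * G (μ 2 - μ j) else 0)
          + (∑ j, (if μ j = μ 2 ∧ μ j + κ j < g then a j else 0)) * G 0 := by
      rw [Finset.sum_mul, ← Finset.sum_add_distrib]
      refine Finset.sum_congr rfl fun j _ => ?_
      by_cases h1 : μ j + κ j < g
      · rcases (hle j).lt_or_eq with h2 | h2
        · simp [h1, h2, h2.ne]
        · rw [if_pos h1, if_neg fun H => H.2.ne h2, if_pos ⟨h2, h1⟩, h2, sub_self, zero_add]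
      · simp [h1]
    rw [this, mul_add, ← mul_assoc, hβ', zero_mul, add_zero]
  -- If γ_j = g, then μ 2 + κ j = g + (μ 2 - μ j), so the initial-value part is β times the
  -- resolvent equation at σ = g, less the terms with γ_j < g. Of these, the ones of top order are
  -- all multiples of R_g and cancel by hypothesis. Every remaining index exceeds g or equals μ 2 +
  -- 1, hence exceeds every γ_j.
  have hy : ∀ x, 0 < x → threeTermSolution μ a b κ a₄ F x =
      β * rlKernel g x + (∑ l, -(β * c l) * resolventKernel μ a a₄ (e l) x
        + (-(β * a₄) * resolventKernel μ a a₄ (g + μ 2) x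
        + (F₀ * resolventKernel μ a a₄ (μ 2 + 1) x
        + vconv (resolventKernel μ a a₄ (μ 2 + 1)) φ x))) := by
    intro x hx
    have hUr := volterraContinuous_resolventKernel h a₄ hr
    have e1 : vconv (resolventKernel μ a a₄ (μ 2)) F x
        = F₀ * resolventKernel μ a a₄ (μ 2 + 1) x
          + vconv (resolventKernel μ a a₄ (μ 2 + 1)) φ x := by
      rw [vconv_congr hx.le (fun _ _ => rfl) (fun u hu => hF u hu.1), vconv_add_right
        (hUr.bounded.integrable_mul (volterraContinuous_const F₀).bounded hx)
        (hUr.bounded.integrable_mul ((volterraContinuous_const 1).vconv hφ.bounded).bounded hx),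
        vconv_assoc hUr (volterraContinuous_const 1) hφ hx]
      have e0 : ∀ u, 0 < u → vconv (resolventKernel μ a a₄ (μ 2)) (fun _ => 1) u
          = resolventKernel μ a a₄ (μ 2 + 1) u := fun u hu => by
        rw [resolventKernel_add_one h a₄ hr hu, vconv_comm]
      congr 1
      · rw [← e0 x hx, ← vconv_const_mul_right]
        simp only [mul_one]
      · exact vconv_congr hx.le (fun u hu => e0 u hu.1) fun _ _ => rfl
    have e2 : ∑ j, a j * b j * resolventKernel μ a a₄ (μ 2 + κ j) x
        = β * ∑ j, a j * resolventKernel μ a a₄ (g + (μ 2 - μ j)) x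
          - β * ∑ j, (if μ j + κ j < g then
            a j * resolventKernel μ a a₄ (g + (μ 2 - μ j)) x else 0) := by
      rw [Finset.mul_sum, Finset.mul_sum, ← Finset.sum_sub_distrib]
      refine Finset.sum_congr rfl fun j _ => ?_
      rw [hb j]
      by_cases h1 : μ j + κ j = g
      · rw [if_pos h1, if_neg h1.not_lt, show g + (μ 2 - μ j) = μ 2 + κ j by linarith]
        ring
      · rw [if_neg h1, if_pos (lt_of_le_of_ne (hg j) h1)]
        ring
    have e3 : ∑ j, (if μ j + κ j < g ∧ μ j < μ 2 then
        a j * resolventKernel μ a a₄ (g + (μ 2 - μ j)) x else 0)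
        = ∑ l, c l * resolventKernel μ a a₄ (e l) x := by
      refine Finset.sum_congr rfl fun j _ => ?_
      simp only [hc, he]
      split_ifs <;> simp
    have e4 := resolventKernel_eq h a₄ hg0 hx
    rw [threeTermSolution, e1, e2, hsplit fun τ => resolventKernel μ a a₄ (g + τ) x, e3, ← e4]
    simp only [Fin.sum_univ_three]
    ring
  refine ⟨fun j x => β * (if μ j + κ j = g then 0 else rlKernel (g - (μ j + κ j)) x)
      + (∑ l, -(β * c l) * resolventKernel μ a a₄ (e l - (μ j + κ j)) x
      + (-(β * a₄) * resolventKernel μ a a₄ (g + μ 2 - (μ j + κ j)) x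
      + (F₀ * resolventKernel μ a a₄ (μ 2 + 1 - (μ j + κ j)) x
      + vconv (resolventKernel μ a a₄ (μ 2 + 1 - (μ j + κ j))) φ x))),
    fun j x => β * (if μ j + κ j = g then 0 else rlKernel (g - μ j) x)
      + (∑ l, -(β * c l) * resolventKernel μ a a₄ (e l - μ j) x
      + (-(β * a₄) * resolventKernel μ a a₄ (g + μ 2 - μ j) x
      + (F₀ * resolventKernel μ a a₄ (μ 2 + 1 - μ j) x
      + vconv (resolventKernel μ a a₄ (μ 2 + 1 - μ j)) φ x))), fun j => ?_, fun x hx => ?_⟩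
  · have hU : ∀ σ, μ j + κ j < σ → HasHilferDerivative (s j) (κ j) (resolventKernel μ a a₄ σ) 0
        (resolventKernel μ a a₄ (σ - (μ j + κ j))) (resolventKernel μ a a₄ (σ - μ j)) :=
      fun σ hσ => hasHilferDerivative_resolventKernel h a₄ (hκ j) (hs j) (hμ j) (hsum j) hσ
    have h1 : μ j + κ j < μ 2 + 1 := by linarith [hγ1 j]
    have h2 : μ j + κ j < g + μ 2 := by linarith [hg j]
    have add := fun {y y' w w' D D' b b'} (A : HasHilferDerivative (s j) (κ j) y b w D)
      (B : HasHilferDerivative (s j) (κ j) y' b' w' D') => A.add (hs j) (hκ j) B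
    refine (add ((hasHilferDerivative_rlKernel (hκ j) (hs j) (hμ j) (hsum j) (hg j)).const_mul β)
      (add (HasHilferDerivative.sum (hs j) (hκ j) Finset.univ fun l =>
        (hU (e l) ((hg j).trans_lt (heg l))).const_mul (-(β * c l)))
      (add ((hU _ h2).const_mul (-(β * a₄))) (add ((hU _ h1).const_mul F₀)
        (hasHilferDerivative_vconv h a₄ (hκ j) (hs j) (hμ j) (hsum j) h1 hφ))))).congr
      hy ?_ fun x _ => rfl
    rw [hb j]
    simp
  · have r1 : ∀ σ, 0 < σ - μ 2 → (∑ j, a j * resolventKernel μ a a₄ (σ - μ j) x)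
        = rlKernel (σ - μ 2) x - a₄ * resolventKernel μ a a₄ σ x := fun σ hσ => by
      rw [← resolventKernel_eq h a₄ hσ hx, sub_add_cancel, add_sub_cancel_right]
      refine Finset.sum_congr rfl fun j _ => ?_
      congr 2; ring
    have r2 : (∑ j, a j * vconv (resolventKernel μ a a₄ (μ 2 + 1 - μ j)) φ x)
        = vconv (fun _ => 1) φ x - a₄ * vconv (resolventKernel μ a a₄ (μ 2 + 1)) φ x := by
      have := resolventKernel_eq_vconv h a₄ one_pos hφ.bounded hx
      rw [rlKernel_one_eq] at this
      rw [← this, add_comm (μ 2) 1, add_sub_cancel_right]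
      refine Finset.sum_congr rfl fun j _ => ?_
      congr 3; ring
    -- The contribution of β h_g to the equation is cancelled by the powers that `r4` extracts from
    -- the correction terms -β c_l R_{e_l}.
    have r3 : β * ∑ j, a j * (if μ j + κ j = g then 0 else rlKernel (g - μ j) x)
        = β * ∑ l, c l * rlKernel (e l - μ 2) x := by
      have hl := hsplit fun τ => rlKernel (g + (τ - μ 2)) x
      rw [show ∑ j, a j * (if μ j + κ j = g then 0 else rlKernel (g - μ j) x)
          = ∑ j, (if μ j + κ j < g then a j * rlKernel (g + (μ 2 - μ j - μ 2)) x else 0) from ?_,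
        hl]
      · congr 1
        refine Finset.sum_congr rfl fun l _ => ?_
        simp only [hc, he]
        split_ifs
        · congr 2; ring
        · simp
      · refine Finset.sum_congr rfl fun j _ => ?_
        by_cases h1 : μ j + κ j = g
        · simp [h1]
        · rw [if_neg h1, if_pos (lt_of_le_of_ne (hg j) h1)]
          congr 2; ring
    have r4 : (∑ j, a j * ∑ l, -(β * c l) * resolventKernel μ a a₄ (e l - μ j) x)
        = ∑ l, -(β * c l) * (rlKernel (e l - μ 2) x - a₄ * resolventKernel μ a a₄ (e l) x) := by
      simp only [Finset.mul_sum]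
      rw [Finset.sum_comm]
      refine Finset.sum_congr rfl fun l _ => ?_
      rw [← r1 _ (her l), Finset.mul_sum]
      exact Finset.sum_congr rfl fun j _ => by ring
    have r5 := r1 (g + μ 2) (by linarith)
    have r6 := r1 (μ 2 + 1) (by linarith)
    rw [add_sub_cancel_right] at r5
    rw [add_sub_cancel_left, rlKernel_one] at r6
    rw [hy x hx, hF x hx]
    simp only [mul_add, Finset.sum_add_distrib, r2, r4]
    have t1 : ∑ j, a j * (β * (if μ j + κ j = g then 0 else rlKernel (g - μ j) x))
        = β * ∑ l, c l * rlKernel (e l - μ 2) x := by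
      rw [← r3, Finset.mul_sum]
      exact Finset.sum_congr rfl fun j _ => by ring
    have t2 : ∀ (C σ : ℝ), ∑ j, a j * (C * resolventKernel μ a a₄ (σ - μ j) x)
        = C * ∑ j, a j * resolventKernel μ a a₄ (σ - μ j) x := fun C σ => by
      rw [Finset.mul_sum]
      exact Finset.sum_congr rfl fun j _ => by ring
    rw [t1, t2, t2, r5, r6]
    simp only [Fin.sum_univ_three]
    ring

/-! ### The time change and transport of functions -/

/-- The assumptions on the time change `Ψ`. -/
structure IsTimeChange (Ψ : ℝ → ℝ) : Prop where
  zero : Ψ 0 = 0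
  cont : ContinuousOn Ψ (Ici 0)
  diff : ContDiffOn ℝ 1 Ψ (Ioi 0)
  deriv_pos : ∀ t : ℝ, 0 < t → 0 < deriv Ψ t

namespace IsTimeChange

variable {Ψ : ℝ → ℝ}

lemma strictMonoOn (h : IsTimeChange Ψ) : StrictMonoOn Ψ (Ici 0) :=
  strictMonoOn_of_deriv_pos (convex_Ici 0) h.cont fun x hx => h.deriv_pos x (by simpa using hx)

lemma pos (h : IsTimeChange Ψ) {t : ℝ} (ht : 0 < t) : 0 < Ψ t := by
  have := h.strictMonoOn (mem_Ici.2 le_rfl) (mem_Ici.2 ht.le) ht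
  rwa [h.zero] at this

lemma hasDerivAt (h : IsTimeChange Ψ) {t : ℝ} (ht : 0 < t) : HasDerivAt Ψ (deriv Ψ t) t :=
  (differentiableAt_of_deriv_ne_zero (h.deriv_pos t ht).ne').hasDerivAt

lemma continuousOn_deriv (h : IsTimeChange Ψ) : ContinuousOn (deriv Ψ) (Ioi 0) :=
  h.diff.continuousOn_deriv_of_isOpen isOpen_Ioi le_rfl

lemma exists_eq (h : IsTimeChange Ψ) {t x : ℝ} (ht : 0 < t) (hx : x ∈ Ioc 0 (Ψ t)) :
    ∃ u ∈ Ioc 0 t, Ψ u = x := by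
  obtain ⟨u, hu, rfl⟩ := intermediate_value_Icc ht.le (h.cont.mono Icc_subset_Ici_self)
    (show x ∈ Icc (Ψ 0) (Ψ t) by rw [h.zero]; exact ⟨hx.1.le, hx.2⟩)
  refine ⟨u, ⟨lt_of_le_of_ne hu.1 ?_, hu.2⟩, rfl⟩
  rintro rfl
  exact absurd hx.1 (by rw [h.zero]; exact lt_irrefl _)

lemma lt_iff (h : IsTimeChange Ψ) {u t : ℝ} (hu : 0 < u) (ht : 0 < t) : Ψ u < Ψ t ↔ u < t :=
  h.strictMonoOn.lt_iff_lt (mem_Ici.2 hu.le) (mem_Ici.2 ht.le)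

lemma le_iff (h : IsTimeChange Ψ) {u t : ℝ} (hu : 0 < u) (ht : 0 < t) : Ψ u ≤ Ψ t ↔ u ≤ t :=
  h.strictMonoOn.le_iff_le (mem_Ici.2 hu.le) (mem_Ici.2 ht.le)

lemma exists_eq_Ioo (h : IsTimeChange Ψ) {t x : ℝ} (ht : 0 < t) (hx : x ∈ Ioo 0 (Ψ t)) :
    ∃ u ∈ Ioo 0 t, Ψ u = x := by
  obtain ⟨u, hu, rfl⟩ := h.exists_eq ht ⟨hx.1, hx.2.le⟩
  exact ⟨u, ⟨hu.1, (h.lt_iff hu.1 ht).1 hx.2⟩, rfl⟩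

lemma image_Ioo (h : IsTimeChange Ψ) {t : ℝ} (ht : 0 < t) : Ψ '' Ioo 0 t = Ioo 0 (Ψ t) := by
  ext x
  constructor
  · rintro ⟨u, hu, rfl⟩
    exact ⟨h.pos hu.1, (h.lt_iff hu.1 ht).2 hu.2⟩
  · exact h.exists_eq_Ioo ht

lemma invFunOn_apply (h : IsTimeChange Ψ) {t : ℝ} (ht : 0 ≤ t) :
    Function.invFunOn Ψ (Ici 0) (Ψ t) = t :=
  h.strictMonoOn.injOn.leftInvOn_invFunOn ht

lemma continuousAt_invFunOn (h : IsTimeChange Ψ) {t : ℝ} (ht : 0 < t) :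
    ContinuousAt (Function.invFunOn Ψ (Ici 0)) (Ψ t) := by
  have ht1 : 0 < t + 1 := by linarith
  refine continuousAt_of_monotoneOn_of_image_mem_nhds (s := Ioo 0 (Ψ (t + 1))) ?_
    (Ioo_mem_nhds (h.pos ht) ((h.lt_iff ht ht1).2 (by linarith))) ?_
  · intro x hx y hy hxy
    obtain ⟨u, hu, rfl⟩ := h.exists_eq_Ioo ht1 hx
    obtain ⟨v, hv, rfl⟩ := h.exists_eq_Ioo ht1 hy
    rw [h.invFunOn_apply hu.1.le, h.invFunOn_apply hv.1.le]
    exact (h.le_iff hu.1 hv.1).1 hxy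
  · rw [h.invFunOn_apply ht.le]
    refine mem_of_superset (Ioo_mem_nhds ht (by linarith : t < t + 1)) fun u hu => ?_
    exact ⟨Ψ u, ⟨h.pos hu.1, (h.lt_iff hu.1 ht1).2 hu.2⟩, h.invFunOn_apply hu.1.le⟩

lemma hasDerivWithinAt (h : IsTimeChange Ψ) (t : ℝ) :
    ∀ x ∈ Ioo 0 t, HasDerivWithinAt Ψ (deriv Ψ x) (Ioo 0 t) x :=
  fun _ hx => (h.hasDerivAt hx.1).hasDerivWithinAt

lemma injOn_Ioo (h : IsTimeChange Ψ) (t : ℝ) : InjOn Ψ (Ioo 0 t) :=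
  h.strictMonoOn.injOn.mono fun _ hx => hx.1.le

/-- The change of variables is made on the open interval, where Ψ is injective and differentiable.
Nothing is needed about Ψ' near 0; its integrability there follows by taking G = 1. -/
lemma intervalIntegrable_comp_iff (h : IsTimeChange Ψ) {t : ℝ} (ht : 0 < t) (G : ℝ → ℝ) :
    IntervalIntegrable G volume 0 (Ψ t) ↔
      IntervalIntegrable (fun s => deriv Ψ s * G (Ψ s)) volume 0 t := by
  rw [intervalIntegrable_iff_integrableOn_Ioo_of_le (h.pos ht).le,
    intervalIntegrable_iff_integrableOn_Ioo_of_le ht.le, ← h.image_Ioo ht,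
    integrableOn_image_iff_integrableOn_abs_deriv_smul measurableSet_Ioo (h.hasDerivWithinAt t)
      (h.injOn_Ioo t)]
  refine integrableOn_congr_fun (fun s hs => ?_) measurableSet_Ioo
  simp only [smul_eq_mul, abs_of_pos (h.deriv_pos s hs.1)]

lemma integral_comp (h : IsTimeChange Ψ) {t : ℝ} (ht : 0 < t) (G : ℝ → ℝ) :
    ∫ x in (0 : ℝ)..Ψ t, G x = ∫ s in (0 : ℝ)..t, deriv Ψ s * G (Ψ s) := by
  rw [intervalIntegral.integral_of_le (h.pos ht).le, intervalIntegral.integral_of_le ht.le,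
    integral_Ioc_eq_integral_Ioo, integral_Ioc_eq_integral_Ioo, ← h.image_Ioo ht,
    integral_image_eq_integral_abs_deriv_smul measurableSet_Ioo (h.hasDerivWithinAt t)
      (h.injOn_Ioo t)]
  refine setIntegral_congr_fun measurableSet_Ioo fun s hs => ?_
  simp only [smul_eq_mul, abs_of_pos (h.deriv_pos s hs.1)]

/-- The `Ψ`-integral is the Riemann–Liouville integral after the substitution `x = Ψ(t)`. -/
lemma psiIntegral_eq (h : IsTimeChange Ψ) {t : ℝ} (ht : 0 < t) (s : ℝ) {y Y : ℝ → ℝ}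
    (hY : ∀ u ∈ Ioc 0 t, Y (Ψ u) = y u) : psiIntegral Ψ s y t = rlIntegral s Y (Ψ t) := by
  unfold psiIntegral rlIntegral
  split_ifs
  · exact (hY t ⟨ht, le_rfl⟩).symm
  · rw [vconv, h.integral_comp ht, ← intervalIntegral.integral_const_mul]
    refine integral_congr_Ioo ht.le fun u hu => ?_
    rw [hY u ⟨hu.1, hu.2.le⟩, rlKernel]
    ring

lemma psiConvIntegrand_eq (h : IsTimeChange Ψ) {t : ℝ} (ht : 0 < t) {K k F f : ℝ → ℝ}
    (hK : ∀ u, 0 < u → k u = K (Ψ u)) (hF : ∀ u ∈ Ioc 0 t, F (Ψ u) = f u) :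
    ∀ u ∈ Ioo 0 t, psiConvIntegrand Ψ k f t u = deriv Ψ u * (K (Ψ t - Ψ u) * F (Ψ u)) := by
  intro u hu
  have hlt := (h.lt_iff hu.1 ht).2 hu.2
  obtain ⟨v, hv, hvu⟩ := h.exists_eq ht (x := Ψ t - Ψ u)
    ⟨by linarith, by linarith [h.pos hu.1]⟩
  rw [psiConvIntegrand, ← hvu, h.invFunOn_apply hv.1.le, hK v hv.1, hF u ⟨hu.1, hu.2.le⟩]
  ring

lemma psiConv_eq (h : IsTimeChange Ψ) {t : ℝ} (ht : 0 < t) {K k F f : ℝ → ℝ}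
    (hK : ∀ u, 0 < u → k u = K (Ψ u)) (hF : ∀ u ∈ Ioc 0 t, F (Ψ u) = f u) :
    psiConv Ψ k f t = vconv K F (Ψ t) := by
  rw [vconv, h.integral_comp ht, psiConv]
  exact integral_congr_Ioo ht.le (h.psiConvIntegrand_eq ht hK hF)

lemma intervalIntegrable_psiConvIntegrand (h : IsTimeChange Ψ) {t : ℝ} (ht : 0 < t)
    {K k F f : ℝ → ℝ} (hK : ∀ u, 0 < u → k u = K (Ψ u)) (hF : ∀ u ∈ Ioc 0 t, F (Ψ u) = f u)
    (hKb : VolterraBounded K) (hFb : VolterraBounded F) :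
    IntervalIntegrable (psiConvIntegrand Ψ k f t) volume 0 t :=
  intervalIntegrable_congr_Ioo ht.le (fun u hu => (h.psiConvIntegrand_eq ht hK hF u hu).symm)
    ((h.intervalIntegrable_comp_iff ht _).1 (hKb.integrable_mul hFb (h.pos ht)))

/-- Functions on `(0, T]` transported to `(0, Ψ T]` and extended by zero. -/
lemma exists_integrable_transport (h : IsTimeChange Ψ) {T : ℝ} (hT : 0 < T) {u : ℝ → ℝ}
    (hu : IntervalIntegrable (fun s => deriv Ψ s * u s) volume 0 T) :
    ∃ U : ℝ → ℝ, IntegrableNearZero U ∧ (∀ s ∈ Ioc 0 T, U (Ψ s) = u s) ∧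
      ∀ M : ℝ, (∀ s ∈ Ioc 0 T, |u s| ≤ M) → ∀ x, |U x| ≤ max M 0 := by
  obtain ⟨Φ, hΦ⟩ : ∃ Φ : ℝ → ℝ, ∀ {t : ℝ}, 0 ≤ t → Φ (Ψ t) = t :=
    ⟨_, h.invFunOn_apply⟩
  have hmem : ∀ s ∈ Ioc 0 T, Ψ s ∈ Ioc 0 (Ψ T) := fun s hs =>
    ⟨h.pos hs.1, (h.le_iff hs.1 hT).2 hs.2⟩
  refine ⟨(Ioc 0 (Ψ T)).indicator fun x => u (Φ x), fun X _ => ?_, fun s hs => ?_,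
    fun M hM x => ?_⟩
  · have h1 : IntervalIntegrable (fun x => u (Φ x)) volume 0 (Ψ T) := by
      rw [h.intervalIntegrable_comp_iff hT]
      refine intervalIntegrable_congr_Ioo hT.le (fun s hs => ?_) hu
      rw [hΦ hs.1.le]
    rw [intervalIntegrable_iff_integrableOn_Ioc_of_le (h.pos hT).le] at h1
    exact (h1.integrable_indicator measurableSet_Ioc).intervalIntegrable
  · rw [indicator_of_mem (hmem s hs), hΦ hs.1.le]
  · by_cases hx : x ∈ Ioc 0 (Ψ T)
    · obtain ⟨s, hs, rfl⟩ := h.exists_eq hT hx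
      rw [indicator_of_mem hx, hΦ hs.1.le]
      exact (hM s hs).trans (le_max_left _ _)
    · rw [indicator_of_notMem hx, abs_zero]
      exact le_max_right _ _

/-- Continuous functions on `(0, T]` transported to `(0, Ψ T]` and extended by a constant. -/
lemma exists_continuous_transport (h : IsTimeChange Ψ) {T : ℝ} (hT : 0 < T) {u : ℝ → ℝ}
    (hc : ContinuousOn u (Ioi 0))
    (hu : IntervalIntegrable (fun s => deriv Ψ s * u s) volume 0 T) :
    ∃ U : ℝ → ℝ, VolterraContinuous U ∧ ∀ s ∈ Ioc 0 T, U (Ψ s) = u s := by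
  obtain ⟨Φ, hΦ, hΦc⟩ : ∃ Φ : ℝ → ℝ, (∀ {t : ℝ}, 0 ≤ t → Φ (Ψ t) = t) ∧
      ∀ {t : ℝ}, 0 < t → ContinuousAt Φ (Ψ t) :=
    ⟨_, h.invFunOn_apply, h.continuousAt_invFunOn⟩
  have hX := h.pos hT
  have hmin : ∀ s ∈ Ioc 0 T, min (Ψ s) (Ψ T) = Ψ s := fun s hs =>
    min_eq_left ((h.le_iff hs.1 hT).2 hs.2)
  have hval : ∀ s ∈ Ioc 0 T, u (Φ (min (Ψ s) (Ψ T))) = u s := fun s hs => by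
    rw [hmin s hs, hΦ hs.1.le]
  have hcont : ContinuousOn (fun x => u (Φ (min x (Ψ T)))) (Ioi 0) := by
    intro x hx
    obtain ⟨s, hs, hsx⟩ := h.exists_eq hT (x := min x (Ψ T)) ⟨lt_min hx hX, min_le_right _ _⟩
    have c1 : ContinuousAt Φ (min x (Ψ T)) := hsx ▸ hΦc hs.1
    have c2 : ContinuousAt u (Φ (min x (Ψ T))) := by
      rw [← hsx, hΦ hs.1.le]
      exact hc.continuousAt (Ioi_mem_nhds hs.1)
    have c3 : ContinuousAt (fun x => min x (Ψ T)) x := by fun_prop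
    exact (ContinuousAt.comp (f := fun x => Φ (min x (Ψ T))) c2
      (ContinuousAt.comp (f := fun x => min x (Ψ T)) c1 c3)).continuousWithinAt
  refine ⟨_, ⟨fun X hX' => ?_, hcont⟩, hval⟩
  refine IntervalIntegrable.trans (b := Ψ T) ?_ ?_
  · rw [h.intervalIntegrable_comp_iff hT]
    refine intervalIntegrable_congr_Ioo hT.le (fun s hs => ?_) hu
    rw [hval s ⟨hs.1, hs.2.le⟩]
  · refine (hcont.mono fun x hx => ?_).intervalIntegrable
    rw [uIcc, mem_Icc] at hx
    exact (lt_min hX hX').trans_le hx.1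

lemma tendsto_zero (h : IsTimeChange Ψ) : Tendsto Ψ (𝓝[>] 0) (𝓝[>] 0) := by
  refine tendsto_nhdsWithin_iff.2 ⟨?_, ?_⟩
  · have := (h.cont 0 (mem_Ici.2 le_rfl)).tendsto
    rw [h.zero] at this
    exact this.mono_left (nhdsWithin_mono _ Ioi_subset_Ici_self)
  · filter_upwards [self_mem_nhdsWithin] with t ht using h.pos ht

lemma intervalIntegrable_deriv (h : IsTimeChange Ψ) {T : ℝ} (hT : 0 < T) :
    IntervalIntegrable (deriv Ψ) volume 0 T := by
  simpa using (h.intervalIntegrable_comp_iff hT fun _ => 1).1 intervalIntegrable_const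

lemma psiDeriv_mul (h : IsTimeChange Ψ) (y : ℝ → ℝ) {t : ℝ} (ht : 0 < t) :
    deriv Ψ t * psiDeriv Ψ y t = deriv y t := by
  have := (h.deriv_pos t ht).ne'
  rw [psiDeriv]; field_simp

end IsTimeChange

/-! ### The explicit formula and the original problem -/

lemma psiHilfer_of_lt_one (Ψ : ℝ → ℝ) {μ : ℝ} (hμ : μ < 1) (ν : ℝ) (y : ℝ → ℝ) :
    psiHilfer Ψ μ ν y = psiIntegral Ψ (ν * (1 - μ))
      (psiDeriv Ψ (psiIntegral Ψ ((1 - ν) * (1 - μ)) y)) := by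
  simp [psiHilfer, Nat.floor_eq_zero.2 hμ]

section Formula

variable {μ ν a b : Fin 3 → ℝ} {a₄ : ℝ} {Ψ f F : ℝ → ℝ}

lemma threeTermKernel_eq (h : IsTimeChange Ψ) (k i : ℕ) {t : ℝ} (ht : 0 < t) :
    threeTermKernel Ψ μ a a₄ k i t
      = prabhakarKernel (a₄ / a 2) (μ 2) k (threeTermExponent μ k i) (Ψ t) :=
  prabhakarKernel_eq _ _ _ _ (h.pos ht)

lemma AdmissibleOrders.volterraContinuous_kernel (hA : AdmissibleOrders μ a) (a₄ : ℝ) (k i : ℕ) :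
    VolterraContinuous (prabhakarKernel (a₄ / a 2) (μ 2) k (threeTermExponent μ k i)) := by
  obtain ⟨l, θ, hl, -, hc, -⟩ := hA.exists_weight (a₄ / a 2)
  exact volterraContinuous_prabhakarKernel (hA.order_pos 2).le hl hc
    (add_pos_of_nonneg_of_pos (hA.shift_nonneg k i) (hA.order_pos 2)) k

/-- By `prabhakarKernel_eq` each power times Prabhakar function is a Prabhakar kernel, and ρ_{k,i}
is μ 2 plus the shift occurring in `threeTermSum`. The sum over i therefore produces resolvent terms
of index μ 2 + ν_j (1 - μ_j) for the initial values and of index μ 2 for the convolution. -/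
lemma threeTermSummand_eq (h : IsTimeChange Ψ) (hA : AdmissibleOrders μ a)
    (hF : VolterraBounded F) {t : ℝ} (ht : 0 < t) (hFf : ∀ u ∈ Ioc 0 t, F (Ψ u) = f u) (k : ℕ) :
    threeTermSummand Ψ μ ν a b a₄ f t k
      = (∑ j, a j * b j * resolventTerm μ a a₄ (μ 2 + ν j * (1 - μ j)) k (Ψ t))
        + vconv (resolventTerm μ a a₄ (μ 2) k) F (Ψ t) := by
  have hx := h.pos ht
  have hK := hA.volterraContinuous_kernel a₄ k
  have e1 : vconv (resolventTerm μ a a₄ (μ 2) k) F (Ψ t)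
      = (-1) ^ k / a 2 ^ (k + 1) * ∑ i ∈ Finset.range (k + 1),
        (Nat.choose k i : ℝ) * a 0 ^ i * a 1 ^ (k - i) *
          psiConv Ψ (threeTermKernel Ψ μ a a₄ k i) f t := by
    rw [vconv_comm]
    change vconv _ (fun y => _ / _ * ∑ i ∈ _, _) _ = _
    rw [vconv_const_mul_right, vconv_sum_right]
    · congr 1
      refine Finset.sum_congr rfl fun i _ => ?_
      rw [vconv_const_mul_right, h.psiConv_eq ht (fun u hu => threeTermKernel_eq h k i hu) hFf,
        vconv_comm, threeTermExponent]
      simp only [add_comm (μ 2)]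
    · intro i _
      have := hF.integrable_mul ((hK i).const_mul
        ((Nat.choose k i : ℝ) * a 0 ^ i * a 1 ^ (k - i))).bounded hx
      simpa only [threeTermExponent, add_comm (μ 2)] using this
  have e2 : ∀ i : ℕ, Ψ t ^ (threeTermExponent μ k i - 1) *
      (∑ j, a j * b j * Ψ t ^ (ν j * (1 - μ j)) *
        prabhakar (μ 2) (threeTermExponent μ k i + ν j * (1 - μ j)) (k + 1)
          (-(a₄ / a 2) * Ψ t ^ μ 2))
      = ∑ j, a j * b j * prabhakarKernel (a₄ / a 2) (μ 2) k
        (μ 2 + ν j * (1 - μ j) + ((μ 2 - μ 1) * k + (μ 1 - μ 0) * i)) (Ψ t) := by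
    intro i
    rw [Finset.mul_sum]
    refine Finset.sum_congr rfl fun j _ => ?_
    rw [show μ 2 + ν j * (1 - μ j) + ((μ 2 - μ 1) * k + (μ 1 - μ 0) * i)
      = threeTermExponent μ k i + ν j * (1 - μ j) by unfold threeTermExponent; ring,
      ← prabhakarKernel_eq _ _ _ _ hx, add_sub_right_comm, Real.rpow_add hx]
    ring
  rw [e1, threeTermSummand]
  simp only [e2]
  simp only [resolventTerm, threeTermSum, Fin.sum_univ_three, mul_add, Finset.sum_add_distrib,
    Finset.mul_sum]
  congr 1
  congr 1
  · congr 1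
    all_goals exact Finset.sum_congr rfl fun i _ => by ring
  · exact Finset.sum_congr rfl fun i _ => by ring

lemma hasSum_threeTermSummand (h : IsTimeChange Ψ) (hA : AdmissibleOrders μ a)
    (hκ : ∀ j, 0 ≤ ν j * (1 - μ j)) (hF : VolterraBounded F) {t : ℝ} (ht : 0 < t)
    (hFf : ∀ u ∈ Ioc 0 t, F (Ψ u) = f u) :
    HasSum (threeTermSummand Ψ μ ν a b a₄ f t)
      (threeTermSolution μ a b (fun j => ν j * (1 - μ j)) a₄ F (Ψ t)) := by
  have hr := hA.order_pos 2
  have h1 := (dominatedSeries_resolvent hA a₄ hr).hasSum_vconv hr hF (h.pos ht)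
  have h2 := hasSum_sum (s := Finset.univ) fun j _ => ((dominatedSeries_resolvent hA a₄
    (add_pos_of_pos_of_nonneg hr (hκ j))).summable (h.pos ht)).hasSum.mul_left (a j * b j)
  exact (h2.add h1).congr_fun fun k => threeTermSummand_eq h hA hF ht hFf k

end Formula

lemma threeTermLHS_eq {Ψ : ℝ → ℝ} {μ ν a : Fin 3 → ℝ} (hμ : ∀ j, μ j < 1) (a₄ : ℝ) (y : ℝ → ℝ)
    (t : ℝ) : threeTermLHS Ψ μ ν a a₄ y t = (∑ j, a j * psiIntegral Ψ (ν j * (1 - μ j))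
      (psiDeriv Ψ (psiIntegral Ψ ((1 - ν j) * (1 - μ j)) y)) t) + a₄ * y t := by
  simp only [threeTermLHS, psiHilfer_of_lt_one Ψ (hμ _)]

/-- Every bounded measurable right-hand side is, on `(0, T]`, the composition of a
Volterra bounded function with `Ψ`. -/
lemma exists_volterraBounded_transport {Ψ f : ℝ → ℝ} (h : IsTimeChange Ψ)
    (hf_meas : AEStronglyMeasurable f (volume.restrict (Ioi 0)))
    (hf_bdd : ∀ T : ℝ, 0 < T → ∃ M : ℝ, ∀ t ∈ Ioc 0 T, |f t| ≤ M) {T : ℝ} (hT : 0 < T) :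
    ∃ F : ℝ → ℝ, VolterraBounded F ∧ ∀ u ∈ Ioc 0 T, F (Ψ u) = f u := by
  obtain ⟨M, hM⟩ := hf_bdd T hT
  have hint : IntervalIntegrable (fun s => deriv Ψ s * f s) volume 0 T := by
    have h1 := h.intervalIntegrable_deriv hT
    rw [intervalIntegrable_iff_integrableOn_Ioc_of_le hT.le] at h1 ⊢
    refine Integrable.mul_bdd (c := M) h1 (hf_meas.mono_set Ioc_subset_Ioi_self) ?_
    exact (ae_restrict_iff' measurableSet_Ioc).2 (Eventually.of_forall hM)
  obtain ⟨F, hF, hFf, hFb⟩ := h.exists_integrable_transport hT hint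
  exact ⟨F, ⟨hF, fun _ _ _ => ⟨_, fun x _ => hFb M hM x⟩⟩, hFf⟩

/-- A function that is absolutely continuous on every `[ε, T]`, with integrable derivative, is
its limit at `0+` plus the integral of its derivative. -/
lemma eq_add_integral_deriv {W : ℝ → ℝ} {b t : ℝ} (ht : 0 < t)
    (hac : ∀ ε T : ℝ, 0 < ε → ε ≤ T → AbsolutelyContinuousOnInterval W ε T)
    (hint : ∀ T : ℝ, 0 < T → IntervalIntegrable (deriv W) volume 0 T)
    (hlim : Tendsto W (𝓝[>] 0) (𝓝 b)) : W t = b + ∫ s in (0 : ℝ)..t, deriv W s := by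
  have h1 : Tendsto (fun ε => W ε + ∫ s in ε..t, deriv W s) (𝓝[>] 0)
      (𝓝 (b + ∫ s in (0 : ℝ)..t, deriv W s)) := by
    have hc := intervalIntegral.continuousOn_primitive_interval' (hint t ht)
      (a := t) right_mem_uIcc
    have h0 : Tendsto (fun ε => ∫ s in t..ε, deriv W s) (𝓝[>] 0) (𝓝 (∫ s in t..0, deriv W s)) := by
      refine (hc 0 left_mem_uIcc).tendsto.mono_left ?_
      rw [uIcc_of_le ht.le]
      exact nhdsWithin_le_of_mem (mem_of_superset (Ioc_mem_nhdsGT ht) Ioc_subset_Icc_self)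
    have := hlim.add h0.neg
    simpa only [← intervalIntegral.integral_symm] using this
  have h2 : (fun ε => W ε + ∫ s in ε..t, deriv W s) =ᶠ[𝓝[>] 0] fun _ => W t := by
    filter_upwards [Ioc_mem_nhdsGT ht] with ε hε
    rw [(hac ε t hε.1 hε.2).integral_deriv_eq_sub]
    ring
  exact tendsto_nhds_unique (tendsto_const_nhds.congr' h2.symm) h1

/-- Every solution of the initial value problem is given by the explicit formula. -/
theorem IsThreeTermSolution.eq_threeTermFormula {Ψ f y : ℝ → ℝ} {μ ν a b : Fin 3 → ℝ} {a₄ : ℝ}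
    (h : IsTimeChange Ψ) (hA : AdmissibleOrders μ a) (hμ : ∀ j, μ j < 1)
    (hν : ∀ j, 0 ≤ ν j ∧ ν j ≤ 1) (hf_meas : AEStronglyMeasurable f (volume.restrict (Ioi 0)))
    (hf_bdd : ∀ T : ℝ, 0 < T → ∃ M : ℝ, ∀ t ∈ Ioc 0 T, |f t| ≤ M)
    (hy : IsThreeTermSolution Ψ μ ν a b a₄ f y) {t : ℝ} (ht : 0 < t) :
    y t = threeTermFormula Ψ μ ν a b a₄ f t := by
  have hκ : ∀ j, 0 ≤ ν j * (1 - μ j) := fun j => mul_nonneg (hν j).1 (by linarith [hμ j])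
  have hs : ∀ j, 0 ≤ (1 - ν j) * (1 - μ j) := fun j =>
    mul_nonneg (by linarith [(hν j).2]) (by linarith [hμ j])
  set W : Fin 3 → ℝ → ℝ := fun j => psiIntegral Ψ ((1 - ν j) * (1 - μ j)) y
  -- Working up to t + 1 places Ψ t inside the open interval on which the transformed uniqueness
  -- statement applies.
  have hT : 0 < t + 1 := by linarith
  obtain ⟨F, hF, hFf⟩ := exists_volterraBounded_transport h hf_meas hf_bdd hT
  obtain ⟨Y, hY, hYy⟩ := h.exists_continuous_transport hT hy.continuousOn (hy.integrable _ hT)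
  have hw : ∀ j, ∃ U : ℝ → ℝ, IntegrableNearZero U ∧
      ∀ s ∈ Ioc 0 (t + 1), U (Ψ s) = psiDeriv Ψ (W j) s := fun j => by
    obtain ⟨U, h1, h2, -⟩ := h.exists_integrable_transport hT (u := psiDeriv Ψ (W j))
      (intervalIntegrable_congr_Ioo hT.le (fun s hs => (h.psiDeriv_mul _ hs.1).symm)
        (hy.deriv_integrable j _ hT))
    exact ⟨U, h1, h2⟩
  choose w hwi hww using hw
  have hmem : Ψ t ∈ Ioo 0 (Ψ (t + 1)) := ⟨h.pos ht, (h.lt_iff ht hT).2 (by linarith)⟩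
  rw [← hYy t ⟨ht, by linarith⟩, threeTermFormula, (hasSum_threeTermSummand h hA hκ hF ht
    fun u hu => hFf u ⟨hu.1, by linarith [hu.2]⟩).tsum_eq]
  refine eq_threeTermSolution hA hκ hs (fun j => by ring) hY hF hwi ?_ ?_ _ hmem
  · intro j x hx
    obtain ⟨u, hu, rfl⟩ := h.exists_eq_Ioo hT hx
    have hle : ∀ v ∈ Ioc 0 u, v ∈ Ioc 0 (t + 1) := fun v hv => ⟨hv.1, hv.2.trans hu.2.le⟩
    rw [← h.psiIntegral_eq hu.1 _ fun v hv => hYy v (hle v hv), vconv_one, h.integral_comp hu.1]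
    refine (eq_add_integral_deriv (W := W j) hu.1 (hy.absCont j) (hy.deriv_integrable j)
      (hy.initial j)).trans ?_
    congr 1
    refine integral_congr_Ioo hu.1.le fun v hv => ?_
    rw [hww j v (hle v ⟨hv.1, hv.2.le⟩), h.psiDeriv_mul _ hv.1]
  · have hnull := hy.equation
    rw [ae_iff] at hnull ⊢
    set N := {u : ℝ | ¬(0 < u → threeTermLHS Ψ μ ν a a₄ y u = f u)}
    -- The equation holds for almost every t and is needed for almost every x = Ψ(t): a
    -- differentiable map sends null sets to null sets.
    have himg : volume (Ψ '' (N ∩ Ioo 0 (t + 1))) = 0 :=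
      addHaar_image_eq_zero_of_differentiableOn_of_addHaar_eq_zero volume
        (fun u hu => (h.hasDerivAt hu.2.1).differentiableAt.differentiableWithinAt)
        (measure_mono_null inter_subset_left hnull)
    refine measure_mono_null (fun x hx => ?_) himg
    simp only [mem_ofPred_eq, Classical.not_imp] at hx
    obtain ⟨u, hu, rfl⟩ := h.exists_eq_Ioo hT hx.1
    refine ⟨u, ⟨fun H => hx.2 ?_, hu⟩, rfl⟩
    have hle : ∀ v ∈ Ioc 0 u, v ∈ Ioc 0 (t + 1) := fun v hv => ⟨hv.1, hv.2.trans hu.2.le⟩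
    rw [hFf u ⟨hu.1, hu.2.le⟩, hYy u ⟨hu.1, hu.2.le⟩, ← H hu.1, threeTermLHS_eq hμ]
    congr 1
    refine Finset.sum_congr rfl fun j _ => ?_
    rw [h.psiIntegral_eq hu.1 _ fun v hv => hww j v (hle v hv)]

/-- A right-hand side with integrable derivative is, on `(0, T]`, the composition with `Ψ` of a
constant plus a primitive. -/
lemma exists_primitive_transport {Ψ f : ℝ → ℝ} (h : IsTimeChange Ψ)
    (hf : ContDiffOn ℝ 1 f (Ioi 0))
    (hf' : ∀ T : ℝ, 0 < T → IntervalIntegrable (deriv f) volume 0 T) {T : ℝ} (hT : 0 < T) :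
    ∃ (F₀ : ℝ) (φ : ℝ → ℝ), VolterraContinuous φ ∧
      ∀ u ∈ Ioc 0 T, F₀ + vconv (fun _ => 1) φ (Ψ u) = f u := by
  have hcf := hf.continuousOn_deriv_of_isOpen isOpen_Ioi le_rfl
  have hc : ContinuousOn (psiDeriv Ψ f) (Ioi 0) :=
    (continuousOn_const.div h.continuousOn_deriv fun u hu => (h.deriv_pos u hu).ne').mul hcf
  obtain ⟨φ, hφ, hφf⟩ := h.exists_continuous_transport hT hc
    (intervalIntegrable_congr_Ioo hT.le (fun s hs => (h.psiDeriv_mul _ hs.1).symm) (hf' T hT))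
  -- The constant is the limit f(0+), which exists because f' is integrable at zero.
  refine ⟨f T - ∫ s in (0 : ℝ)..T, deriv f s, φ, hφ, fun u hu => ?_⟩
  have e1 : vconv (fun _ => 1) φ (Ψ u) = ∫ s in (0 : ℝ)..u, deriv f s := by
    rw [vconv_one, h.integral_comp hu.1]
    refine integral_congr_Ioo hu.1.le fun s hs => ?_
    rw [hφf s ⟨hs.1, hs.2.le.trans hu.2⟩, h.psiDeriv_mul _ hs.1]
  have hsub : uIcc u T ⊆ Ioi 0 := by
    rw [uIcc_of_le hu.2]; exact fun s hs => hu.1.trans_le hs.1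
  have e2 : ∫ s in u..T, deriv f s = f T - f u :=
    intervalIntegral.integral_deriv_eq_sub
      (fun s hs => (hf.differentiableOn one_ne_zero).differentiableAt (Ioi_mem_nhds (hsub hs)))
      (hcf.mono hsub).intervalIntegrable
  have e3 := intervalIntegral.integral_add_adjacent_intervals (hf' u hu.1)
    (hcf.mono hsub).intervalIntegrable
  rw [e1]
  linarith

/-- For compatible initial values the explicit formula is, on every `(0, T]`, the composition
with `Ψ` of a solution of the transformed problem. -/
lemma exists_hasHilferDerivative_threeTermFormula {Ψ f : ℝ → ℝ} {μ ν a b : Fin 3 → ℝ} {a₄ : ℝ}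
    (h : IsTimeChange Ψ) (hA : AdmissibleOrders μ a) (hμ : ∀ j, μ j < 1)
    (hν : ∀ j, 0 ≤ ν j ∧ ν j ≤ 1) (hb : CompatibleInitialValues μ ν a b)
    (hf : ContDiffOn ℝ 1 f (Ioi 0))
    (hf' : ∀ T : ℝ, 0 < T → IntervalIntegrable (deriv f) volume 0 T) {T : ℝ} (hT : 0 < T) :
    ∃ (S : ℝ → ℝ) (w D : Fin 3 → ℝ → ℝ),
      (∀ j, HasHilferDerivative ((1 - ν j) * (1 - μ j)) (ν j * (1 - μ j)) S (b j) (w j) (D j)) ∧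
      (∀ u ∈ Ioc 0 T, S (Ψ u) = threeTermFormula Ψ μ ν a b a₄ f u) ∧
      ∀ u ∈ Ioc 0 T, (∑ j, a j * D j (Ψ u)) + a₄ * threeTermFormula Ψ μ ν a b a₄ f u = f u := by
  have hκ : ∀ j, 0 ≤ ν j * (1 - μ j) := fun j => mul_nonneg (hν j).1 (by linarith [hμ j])
  have hs : ∀ j, 0 ≤ (1 - ν j) * (1 - μ j) := fun j =>
    mul_nonneg (by linarith [(hν j).2]) (by linarith [hμ j])
  obtain ⟨F₀, φ, hφ, hφf⟩ := exists_primitive_transport h hf hf' hT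
  obtain ⟨β, g, hg, hbg, hβ⟩ := hb
  obtain ⟨w, D, hH, heq⟩ := exists_hasHilferDerivative_threeTermSolution hA hκ hs
    (fun j => by ring) a₄ hg hbg hβ hφ (F := fun x => F₀ + vconv (fun _ => 1) φ x)
    fun _ _ => rfl
  have hF : VolterraBounded fun x => F₀ + vconv (fun _ => 1) φ x :=
    ((volterraContinuous_const F₀).add
      ((volterraContinuous_const 1).vconv hφ.bounded)).bounded
  have hval : ∀ u ∈ Ioc 0 T, threeTermSolution μ a b (fun j => ν j * (1 - μ j)) a₄
      (fun x => F₀ + vconv (fun _ => 1) φ x) (Ψ u) = threeTermFormula Ψ μ ν a b a₄ f u :=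
    fun u hu => (hasSum_threeTermSummand h hA hκ hF hu.1
      fun v hv => hφf v ⟨hv.1, hv.2.trans hu.2⟩).tsum_eq.symm
  refine ⟨_, w, D, hH, hval, fun u hu => ?_⟩
  rw [← hval u hu, heq _ (h.pos hu.1), hφf u hu]

section Existence

variable {Ψ y S w D : ℝ → ℝ} {s κ b T t : ℝ}

lemma HasHilferDerivative.psiIntegral_eq (h : IsTimeChange Ψ)
    (hy : ∀ u ∈ Ioc 0 T, S (Ψ u) = y u) (ht : t ∈ Ioc 0 T) :
    psiIntegral Ψ s y t = rlIntegral s S (Ψ t) :=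
  h.psiIntegral_eq ht.1 s fun u hu => hy u ⟨hu.1, hu.2.trans ht.2⟩

lemma HasHilferDerivative.hasDerivAt_psiIntegral (h : IsTimeChange Ψ)
    (H : HasHilferDerivative s κ S b w D) (hy : ∀ u ∈ Ioc 0 T, S (Ψ u) = y u)
    (ht : t ∈ Ioo 0 T) : HasDerivAt (psiIntegral Ψ s y) (w (Ψ t) * deriv Ψ t) t := by
  refine ((H.hasDerivAt (h.pos ht.1)).comp t (h.hasDerivAt ht.1)).congr_of_eventuallyEq ?_
  filter_upwards [Ioo_mem_nhds ht.1 ht.2] with u hu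
  exact psiIntegral_eq h hy ⟨hu.1, hu.2.le⟩

lemma HasHilferDerivative.psiIntegral_psiDeriv (h : IsTimeChange Ψ)
    (H : HasHilferDerivative s κ S b w D) (hy : ∀ u ∈ Ioc 0 T, S (Ψ u) = y u)
    (ht : t ∈ Ioo 0 T) : psiIntegral Ψ κ (psiDeriv Ψ (psiIntegral Ψ s y)) t = D (Ψ t) := by
  rw [← H.deriv_integral_eq _ (h.pos ht.1)]
  refine h.psiIntegral_eq ht.1 _ fun u hu => ?_
  have := (h.deriv_pos u hu.1).ne'
  rw [psiDeriv, (H.hasDerivAt_psiIntegral h hy ⟨hu.1, hu.2.trans_lt ht.2⟩).deriv]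
  field_simp

end Existence

/-- For compatible initial values and regular right-hand side, the explicit formula is a
solution, and it satisfies the equation at every positive time. -/
theorem isThreeTermSolution_threeTermFormula {Ψ f : ℝ → ℝ} {μ ν a b : Fin 3 → ℝ} {a₄ : ℝ}
    (h : IsTimeChange Ψ) (hA : AdmissibleOrders μ a) (hμ : ∀ j, μ j < 1)
    (hν : ∀ j, 0 ≤ ν j ∧ ν j ≤ 1) (hb : CompatibleInitialValues μ ν a b)
    (hf : ContDiffOn ℝ 1 f (Ioi 0))
    (hf' : ∀ T : ℝ, 0 < T → IntervalIntegrable (deriv f) volume 0 T) :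
    IsThreeTermSolution Ψ μ ν a b a₄ f (threeTermFormula Ψ μ ν a b a₄ f) ∧
      ∀ t : ℝ, 0 < t →
        (∀ j : Fin 3, DifferentiableAt ℝ
          (psiIntegral Ψ ((1 - ν j) * (1 - μ j)) (threeTermFormula Ψ μ ν a b a₄ f)) t) ∧
        threeTermLHS Ψ μ ν a a₄ (threeTermFormula Ψ μ ν a b a₄ f) t = f t := by
  -- The transported functions depend on T, the formula does not. Every property to be checked
  -- concerns a bounded time interval, so a suitable T is chosen each time.
  have key := fun {T : ℝ} (hT : 0 < T) =>
    exists_hasHilferDerivative_threeTermFormula (a₄ := a₄) h hA hμ hν hb hf hf' hT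
  have heq : ∀ t : ℝ, 0 < t →
      threeTermLHS Ψ μ ν a a₄ (threeTermFormula Ψ μ ν a b a₄ f) t = f t := fun t ht => by
    obtain ⟨S, w, D, hH, hS, hE⟩ := key (show 0 < t + 1 by linarith)
    rw [threeTermLHS_eq hμ, ← hE t ⟨ht, by linarith⟩]
    congr 1
    refine Finset.sum_congr rfl fun j _ => ?_
    rw [(hH j).psiIntegral_psiDeriv h hS ⟨ht, by linarith⟩]
  refine ⟨⟨fun t ht => ?_, fun T hT => ?_, fun j ε T hε hεT => ?_, fun j T hT => ?_, fun j => ?_,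
    Eventually.of_forall heq⟩, fun t ht => ⟨fun j => ?_, heq t ht⟩⟩
  · have ht : 0 < t := ht
    obtain ⟨S, w, D, hH, hS, -⟩ := key (show 0 < t + 1 by linarith)
    have hc : ContinuousAt (fun u => S (Ψ u)) t :=
      ContinuousAt.comp ((hH 0).cont.cont.continuousAt (Ioi_mem_nhds (h.pos ht)))
        (h.hasDerivAt ht).continuousAt
    refine (hc.congr ?_).continuousWithinAt
    filter_upwards [Ioo_mem_nhds ht (by linarith : t < t + 1)] with u hu
    exact hS u ⟨hu.1, hu.2.le⟩
  · obtain ⟨S, w, D, hH, hS, -⟩ := key hT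
    refine intervalIntegrable_congr_Ioo hT.le (fun u hu => ?_)
      ((h.intervalIntegrable_comp_iff hT S).1 ((hH 0).cont.int _ (h.pos hT)))
    rw [hS u ⟨hu.1, hu.2.le⟩]
  · obtain ⟨S, w, D, hH, hS, -⟩ := key (show 0 < T + 1 by linarith)
    -- The derivative w(Ψ u) Ψ'(u) is continuous on (0, T + 1), so the Ψ-integral is C¹ there and
    -- absolutely continuous on the compact interval [ε, T].
    have hd := fun {u : ℝ} (hu : u ∈ Ioo 0 (T + 1)) => (hH j).hasDerivAt_psiIntegral h hS hu
    have hcd : ContDiffOn ℝ 1 (psiIntegral Ψ ((1 - ν j) * (1 - μ j))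
        (threeTermFormula Ψ μ ν a b a₄ f)) (Ioo 0 (T + 1)) := by
      rw [contDiffOn_one_iff_derivWithin isOpen_Ioo.uniqueDiffOn]
      refine ⟨fun u hu => (hd hu).differentiableAt.differentiableWithinAt, ?_⟩
      have hc : ContinuousOn (fun u => w j (Ψ u) * deriv Ψ u) (Ioo 0 (T + 1)) :=
        ((hH j).cont_deriv.cont.comp (h.cont.mono fun u hu => hu.1.le)
          fun u hu => h.pos hu.1).mul (h.continuousOn_deriv.mono fun u hu => hu.1)
      refine hc.congr fun u hu => ?_
      rw [derivWithin_of_isOpen isOpen_Ioo hu, (hd hu).deriv]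
    refine (hcd.mono fun u hu => ?_).absolutelyContinuousOnInterval
    rw [uIcc_of_le hεT] at hu
    exact ⟨hε.trans_le hu.1, by linarith [hu.2]⟩
  · obtain ⟨S, w, D, hH, hS, -⟩ := key hT
    refine intervalIntegrable_congr_Ioo hT.le (fun u hu => ?_)
      ((h.intervalIntegrable_comp_iff hT (w j)).1 ((hH j).cont_deriv.int _ (h.pos hT)))
    rw [((hH j).hasDerivAt_psiIntegral h hS hu).deriv, mul_comm]
  · obtain ⟨S, w, D, hH, hS, -⟩ := key one_pos
    refine ((hH j).tendsto.comp h.tendsto_zero).congr' ?_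
    filter_upwards [Ioc_mem_nhdsGT one_pos] with u hu
    exact (HasHilferDerivative.psiIntegral_eq h hS hu).symm
  · obtain ⟨S, w, D, hH, hS, -⟩ := key (show 0 < t + 1 by linarith)
    exact ((hH j).hasDerivAt_psiIntegral h hS ⟨ht, by linarith⟩).differentiableAt

end

theorem mainTheorem11 (μ ν a b : Fin 3 → ℝ) (a₄ : ℝ) (Ψ f : ℝ → ℝ)
    (hμ_pos : 0 < μ 0) (hμ_le : μ 0 ≤ μ 1) (hμ_le' : μ 1 ≤ μ 2) (hμ_lt : μ 2 < 1)
    (hν : ∀ j, 0 ≤ ν j ∧ ν j ≤ 1)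
    (ha : |(if μ 0 = μ 2 then a 0 else 0) + (if μ 1 = μ 2 then a 1 else 0)| < |a 2|)
    (hΨ_zero : Ψ 0 = 0) (hΨ_cont : ContinuousOn Ψ (Ici 0)) (hΨ_diff : ContDiffOn ℝ 1 Ψ (Ioi 0))
    (hΨ_deriv : ∀ t : ℝ, 0 < t → 0 < deriv Ψ t)
    (hf_meas : AEStronglyMeasurable f (volume.restrict (Ioi 0)))
    (hf_bdd : ∀ T : ℝ, 0 < T → ∃ M : ℝ, ∀ t ∈ Ioc 0 T, |f t| ≤ M) :
    -- the integrals and the series in the formula converge at every positive time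
    (∀ t : ℝ, 0 < t →
      (∀ k i : ℕ, i ≤ k →
        IntervalIntegrable (psiConvIntegrand Ψ (threeTermKernel Ψ μ a a₄ k i) f t) volume 0 t) ∧
      Summable (threeTermSummand Ψ μ ν a b a₄ f t)) ∧
    -- every solution of the initial value problem is given by the formula
    (∀ y : ℝ → ℝ, IsThreeTermSolution Ψ μ ν a b a₄ f y →
      ∀ t : ℝ, 0 < t → y t = threeTermFormula Ψ μ ν a b a₄ f t) ∧
    -- for compatible initial values and regular `f` the formula is a solution,
    -- and it satisfies the equation at every positive time
    (CompatibleInitialValues μ ν a b → ContDiffOn ℝ 1 f (Ioi 0) →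
      (∀ T : ℝ, 0 < T → IntervalIntegrable (deriv f) volume 0 T) →
      IsThreeTermSolution Ψ μ ν a b a₄ f (threeTermFormula Ψ μ ν a b a₄ f) ∧
      ∀ t : ℝ, 0 < t →
        (∀ j : Fin 3, DifferentiableAt ℝ
          (psiIntegral Ψ ((1 - ν j) * (1 - μ j)) (threeTermFormula Ψ μ ν a b a₄ f)) t) ∧
        threeTermLHS Ψ μ ν a a₄ (threeTermFormula Ψ μ ν a b a₄ f) t = f t) := by
  have h : IsTimeChange Ψ := ⟨hΨ_zero, hΨ_cont, hΨ_diff, hΨ_deriv⟩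
  have hA : AdmissibleOrders μ a := ⟨hμ_pos, hμ_le, hμ_le', ha⟩
  have hμ : ∀ j, μ j < 1 := fun j => (hA.order_le j).trans_lt hμ_lt
  have hκ : ∀ j, 0 ≤ ν j * (1 - μ j) := fun j => mul_nonneg (hν j).1 (by linarith [hμ j])
  refine ⟨fun t ht => ?_, fun y hy t ht => hy.eq_threeTermFormula h hA hμ hν hf_meas hf_bdd ht,
    fun hb hf hf' => isThreeTermSolution_threeTermFormula h hA hμ hν hb hf hf'⟩
  obtain ⟨F, hF, hFf⟩ := exists_volterraBounded_transport h hf_meas hf_bdd ht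
  exact ⟨fun k i _ => h.intervalIntegrable_psiConvIntegrand ht
    (fun u hu => threeTermKernel_eq h k i hu) hFf (hA.volterraContinuous_kernel a₄ k i).bounded hF,
    (hasSum_threeTermSummand h hA hκ hF ht hFf).summable⟩
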